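/- Let $n\ge 1$, $0<t<1$, $1<q<\infty$ with $t\ge 1/q$, let $0<\theta<1$ and $(\tfrac1p,s)=(1-\theta)(\tfrac1q,t)+\theta(1,1)$, and let $\gamma\in\mathbb R\setminus[-1,0]$. For real-valued $u$ on $\mathbb R^n$, $b\in\mathbb R$ and $x,h\in\mathbb R^n$ put $\mathcal Q_b u(x,h)=\frac{|u(x+h)-u(x)|}{|h|^b}$; let $\mathrm d\nu_\gamma=|h|^{\gamma-n}\,\mathrm dx\,\mathrm dh$ on $\mathbb R^n\times\mathbb R^n$; and for $0<r<\infty$ and measurable $F$ on $\mathbb R^n\times\mathbb R^n$ let $$[F]_{L^{p,r}(\nu_\gamma)}=\Big(r\int_0^\infty \lambda^r\,\nu_\gamma\{|F|>\lambda\}^{r/p}\,\frac{\mathrm d\lambda}{\lambda}\Big)^{1/r}\in[0,\infty].$$ Let $\dot W^{t,q}$ be the space of $u\in L^1_{\mathrm{loc}}(\mathbb R^n)$ with $\|u\|_{\dot W^{t,q}}=\Big(\iint_{\mathbb R^n\times\mathbb R^n}\frac{|u(x+h)-u(x)|^q}{|h|^{tq+n}}\,\mathrm dh\,\mathrm dx\Big)^{1/q}<\infty$,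 and let $\mathrm{BV}$ be the space of $u\in L^1_{\mathrm{loc}}(\mathbb R^n)$ with $\|u\|_{\mathrm{BV}}=\sup\big\{\big|\int_{\mathbb R^n}u\operatorname{div}\phi\,\mathrm dx\big|:\phi\in C^1_c(\mathbb R^n;\mathbb R^n),\ \|\phi\|_{L^\infty}\le1\big\}<\infty$. Then the following hold. (i) With $r=\frac{q}{1-\theta}$, there is a finite constant $C$, depending only on $n,t,q,\theta,\gamma$, such that for all $u\in \mathrm{BV}\cap\dot W^{t,q}$ $$[\mathcal Q_{s+\gamma/p}u]_{L^{p,r}(\nu_\gamma)}\le C\,\|u\|_{\dot W^{t,q}}^{1-\theta}\,\|u\|_{\mathrm{BV}}^{\theta}.$$ (ii) If $0<r<\frac{q}{1-\theta}$, this inequality fails on $C_c^\infty(\mathbb R^n)$ for every constant: for every finite $C\ge 0$ there is $u\in C_c^\infty(\mathbb R^n)$ with $$[\mathcal Q_{s+\gamma/p}u]_{L^{p,r}(\nu_\gamma)}> C\,\|u\|_{\dot W^{t,q}}^{1-\theta}\,\|u\|_{\mathrm{BV}}^{\theta}.$$ -/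

import Mathlib

open MeasureTheory
open scoped ENNReal NNReal ContDiff

/-- The difference quotient `|u (x + h) - u x| / |h| ^ b`. -/
noncomputable def diffQuot {n : ℕ} (b : ℝ) (u : EuclideanSpace ℝ (Fin n) → ℝ)
    (z : EuclideanSpace ℝ (Fin n) × EuclideanSpace ℝ (Fin n)) : ℝ :=
  |u (z.1 + z.2) - u z.1| / ‖z.2‖ ^ b

/-- The measure `|h| ^ (γ - n) dx dh` on `ℝⁿ × ℝⁿ`, whose points are written `z = (x, h)`. -/
noncomputable def nuMeasure (n : ℕ) (γ : ℝ) :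
    Measure (EuclideanSpace ℝ (Fin n) × EuclideanSpace ℝ (Fin n)) :=
  ((volume : Measure (EuclideanSpace ℝ (Fin n))).prod volume).withDensity
    (fun z => ENNReal.ofReal (‖z.2‖ ^ (γ - (n : ℝ))))

/-- The Lorentz quasi-norm `(r ∫₀^∞ lam ^ r ν{|f| > lam} ^ (r / p) dlam / lam) ^ (1 / r)`,
for finite exponents `p, r > 0`, with values in `[0, ∞]`. -/
noncomputable def lorentzQuasiNorm {X : Type*} [MeasurableSpace X] (p r : ℝ) (ν : Measure X)
    (f : X → ℝ) : ℝ≥0∞ :=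
  (ENNReal.ofReal r *
    ∫⁻ lam in Set.Ioi (0 : ℝ),
      ENNReal.ofReal (lam ^ (r - 1)) * ν {x | lam < |f x|} ^ (r / p)) ^ (1 / r)

/-- The homogeneous fractional Sobolev (Gagliardo) seminorm
`(∬ (|u (x + h) - u x| / |h| ^ (t + n / q)) ^ q dx dh) ^ (1 / q)`, with values in `[0, ∞]`. -/
noncomputable def fracSobolevNorm {n : ℕ} (t q : ℝ) (u : EuclideanSpace ℝ (Fin n) → ℝ) : ℝ≥0∞ :=
  (∫⁻ z, ENNReal.ofReal (diffQuot (t + (n : ℝ) / q) u z ^ q)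
    ∂((volume : Measure (EuclideanSpace ℝ (Fin n))).prod volume)) ^ (1 / q)

/-- Membership in the homogeneous fractional Sobolev space. -/
def MemFracSobolev {n : ℕ} (t q : ℝ) (u : EuclideanSpace ℝ (Fin n) → ℝ) : Prop :=
  LocallyIntegrable u volume ∧ fracSobolevNorm t q u < ⊤

/-- The divergence of a vector field on `ℝⁿ`. -/
noncomputable def divergence {n : ℕ} (φ : EuclideanSpace ℝ (Fin n) → EuclideanSpace ℝ (Fin n))
    (x : EuclideanSpace ℝ (Fin n)) : ℝ :=
  ∑ i : Fin n, (fderiv ℝ φ x (EuclideanSpace.single i 1)) i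

/-- The total variation of `u`: the supremum of `|∫ u div φ|` over the `C¹` vector fields `φ` with
compact support and `|φ| ≤ 1`, with values in `[0, ∞]`. It is used for locally integrable `u`
only, for which all these integrals converge. -/
noncomputable def bvNorm {n : ℕ} (u : EuclideanSpace ℝ (Fin n) → ℝ) : ℝ≥0∞ :=
  ⨆ (φ : EuclideanSpace ℝ (Fin n) → EuclideanSpace ℝ (Fin n)) (_ : ContDiff ℝ 1 φ)
    (_ : HasCompactSupport φ) (_ : ∀ x, ‖φ x‖ ≤ 1),
    ENNReal.ofReal |∫ x, u x * divergence φ x|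

/-- Membership in the homogeneous space `BV`. -/
def MemBV {n : ℕ} (u : EuclideanSpace ℝ (Fin n) → ℝ) : Prop :=
  LocallyIntegrable u volume ∧ bvNorm u < ⊤

/-! Upper bound. The exponents are affine in `(1/p, s)`, so `Q_{s+γ/p} = Q_{t+γ/q}^{1-θ} ·
Q_{1+γ}^θ` pointwise. The `L^q(ν_γ)` norm of `Q_{t+γ/q}` is exactly the Gagliardo seminorm, because
the powers of `|h|` combine. For `γ ∉ [-1,0]` the quotient `Q_{1+γ}` lies in weak `L^1(ν_γ)` with
norm at most a constant times the total variation (`exists_nuMeasure_diffQuot_le`). A Hölder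
inequality between `L^r` and weak `L^1` (`lintegral_rpow_mul_distribution_le`) then lands in
`L^{p,r}` with `r = q/(1-θ)`, since `r/p = 1 + θr`.

The weak-type bound is one-dimensional and dyadic. Fix a direction and look at the steps `2^i e`.
The superlevel sets at step `2^i e` use a threshold `w_i` growing like `ρ^i`, where `ρ = 2^{1+γ}`.
On a binary tree of subsegments, the sum of the weights of those whose variation exceeds their
weight is at most a constant times the variation of the root. This holds if `ρ > 2`, where the top
of the tree dominates, and if `ρ < 1`, where the bottom does; these are the ranges `γ > 0` and `γ <
-1`. Integrating over `x` and over an annulus of `h`, and using that translation by `h` costs at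
most `|h|` times the total variation in `L^1`, gives the estimate.

Sharpness. Put `d = (tq-1)/(q-1)`, which lies in `[0,1)`. A smoothed Cantor staircase with `N`
generations has uniformly bounded variation and is uniformly `d`-Hölder. Since `tq = 1 + d(q-1)`,
each of the `N` scales between `l^N` and `1` contributes a bounded amount to the Gagliardo integral,
so the seminorm is at most of order `N^{1/q}` (`exists_norm_cantorProfile_le`). At each of these
scales the difference quotient is also large on a set of the critical size
(`exists_le_nuMeasure_cantorProfile`). The levels form a geometric sequence of ratio different from
`1`, because `γ ≠ d - 1`; hence they fill disjoint ranges of `λ`, and the `L^{p,r}` quasi-norm is at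
least of order `N^{1/r}` (`exists_le_lorentzQuasiNorm_of_geometric`). If `1/r > (1-θ)/q`, large `N`
defeats every constant. -/

/-! ### Hölder's inequality between `L^r` and weak `L^1`. -/

theorem setLIntegral_Ioo_rpow {e a : ℝ} (he : 0 ≤ e) (ha : 0 ≤ a) :
    ∫⁻ τ in Set.Ioo 0 a, ENNReal.ofReal ((1 + e) * τ ^ e) = ENNReal.ofReal (a ^ (1 + e)) := by
  rw [← ofReal_integral_eq_lintegral_ofReal]
  · rw [← integral_Ioc_eq_integral_Ioo, ← intervalIntegral.integral_of_le ha,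
      intervalIntegral.integral_const_mul, integral_rpow (Or.inl (by linarith)),
      Real.zero_rpow (by linarith)]
    congr 1
    rw [add_comm e 1]
    field_simp
    ring
  · have : IntervalIntegrable (fun τ : ℝ => (1 + e) * τ ^ e) volume 0 a :=
      (intervalIntegral.intervalIntegrable_rpow' (by linarith)).const_mul _
    exact ((intervalIntegrable_iff_integrableOn_Ioo_of_le ha).1 this)
  · filter_upwards [ae_restrict_mem measurableSet_Ioo] with τ hτ
    have := Real.rpow_nonneg hτ.1.le e
    positivity

/-- Layer-cake for a single number. It is applied to `M = ν{f > y}`, which may be infinite, hence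
the extended-real form; only this direction is needed. -/
theorem rpow_le_lintegral_superlevel {e : ℝ} (he : 0 ≤ e) (M : ℝ≥0∞) :
    M ^ (1 + e) ≤ ∫⁻ τ in Set.Ioi (0 : ℝ),
      {τ : ℝ | ENNReal.ofReal τ < M}.indicator (fun τ => ENNReal.ofReal ((1 + e) * τ ^ e)) τ := by
  have key : ∀ a : ℝ, 0 ≤ a → ENNReal.ofReal a ≤ M →
      ENNReal.ofReal (a ^ (1 + e)) ≤ ∫⁻ τ in Set.Ioi (0 : ℝ),
      {τ : ℝ | ENNReal.ofReal τ < M}.indicator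
        (fun τ => ENNReal.ofReal ((1 + e) * τ ^ e)) τ := by
    intro a ha haM
    rw [← setLIntegral_Ioo_rpow he ha]
    calc _ = ∫⁻ τ in Set.Ioo 0 a, {τ : ℝ | ENNReal.ofReal τ < M}.indicator
            (fun τ => ENNReal.ofReal ((1 + e) * τ ^ e)) τ := by
          refine setLIntegral_congr_fun measurableSet_Ioo fun τ hτ => ?_
          rw [Set.indicator_of_mem]
          exact ((ENNReal.ofReal_lt_ofReal_iff (hτ.1.trans hτ.2)).2 hτ.2).trans_le haM
      _ ≤ _ := lintegral_mono_set fun τ hτ => hτ.1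
  rcases eq_or_ne M ⊤ with rfl | hM
  · rw [ENNReal.top_rpow_of_pos (by linarith), top_le_iff]
    refine ENNReal.eq_top_of_forall_nnreal_le fun c => ?_
    rw [← ENNReal.ofReal_coe_nnreal]
    -- The shift to `c + 1` makes the base at least `1`, so raising it to the power `1 + e` does not
    -- decrease it.
    refine le_trans (ENNReal.ofReal_le_ofReal ?_)
      (key ((c : ℝ) + 1) (by positivity) le_top)
    calc (c : ℝ) ≤ ((c : ℝ) + 1) ^ (1 : ℝ) := by simp
      _ ≤ _ := Real.rpow_le_rpow_of_exponent_le (by simp) (by linarith)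
  · have := key M.toReal ENNReal.toReal_nonneg (by rw [ENNReal.ofReal_toReal hM])
    rwa [← ENNReal.ofReal_rpow_of_nonneg ENNReal.toReal_nonneg (by linarith),
      ENNReal.ofReal_toReal hM] at this

theorem setLIntegral_Ioi_indicator_ofReal_half_lt (M : ℝ≥0∞) :
    ∫⁻ τ in Set.Ioi (0 : ℝ), {τ : ℝ | ENNReal.ofReal (τ / 2) < M}.indicator 1 τ ≤ 2 * M := by
  rcases eq_or_ne M ⊤ with rfl | hM
  · simp
  · rw [lintegral_indicator_one
      (measurableSet_lt (by fun_prop) measurable_const), Measure.restrict_apply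
      (measurableSet_lt (by fun_prop) measurable_const)]
    calc _ ≤ volume (Set.Ioo 0 (2 * M.toReal)) := by
          refine measure_mono fun τ hτ => ⟨hτ.2, ?_⟩
          have h1 : ENNReal.ofReal (τ / 2) < M := hτ.1
          rw [ENNReal.ofReal_lt_iff_lt_toReal (by linarith [hτ.2.out]) hM] at h1
          linarith
      _ = 2 * M := by
          rw [Real.volume_Ioo, sub_zero, ENNReal.ofReal_mul (by norm_num), ENNReal.ofReal_toReal hM]
          simp

/-- Homogeneity of `y ^ (r - 1) dy` under dilation, which later turns a rescaled level into a power
of `τ`. -/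
theorem setLIntegral_Ioi_rpow_mul_comp_mul {r s : ℝ} (hs : 0 < s) (g : ℝ → ℝ≥0∞) :
    ∫⁻ x in Set.Ioi (0 : ℝ), ENNReal.ofReal (x ^ (r - 1)) * g (x * s)
      = ENNReal.ofReal (s ^ (-r)) *
        ∫⁻ y in Set.Ioi (0 : ℝ), ENNReal.ofReal (y ^ (r - 1)) * g y := by
  have himg : (fun x : ℝ => x * s) '' Set.Ioi 0 = Set.Ioi 0 := by
    ext y
    constructor
    · rintro ⟨x, hx, rfl⟩
      exact mul_pos hx hs
    · intro hy
      exact ⟨y / s, div_pos hy hs, by field_simp⟩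
  rw [← lintegral_const_mul' _ _ ENNReal.ofReal_ne_top]
  conv_rhs => rw [← himg]
  rw [lintegral_image_eq_lintegral_abs_deriv_mul measurableSet_Ioi
    (f' := fun _ => s)
    (fun x _ => by simpa using ((hasDerivAt_id x).mul_const s).hasDerivWithinAt)
    (fun x _ y _ h => mul_right_cancel₀ hs.ne' h)]
  refine setLIntegral_congr_fun measurableSet_Ioi fun x hx => ?_
  have hx : 0 < x := hx
  rw [← mul_assoc, ← mul_assoc, ← ENNReal.ofReal_mul (by positivity),
    ← ENNReal.ofReal_mul (by positivity)]
  congr 2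
  rw [Real.mul_rpow hx.le hs.le, abs_of_pos hs, Real.rpow_sub hs, Real.rpow_neg hs.le,
    Real.rpow_one]
  have := (Real.rpow_pos_of_pos hs r).ne'
  field_simp

/-- Hölder's inequality for a product of a function in `L^r` and a power of a function
in weak `L^1`, with value in the Lorentz space of second exponent `r`. -/
theorem lintegral_rpow_mul_distribution_le {X : Type*} [MeasurableSpace X] {ν : Measure X}
    {r θ K : ℝ} (hr : 0 < r) (hθ : 0 < θ) (hK : 0 < K) {f G k : X → ℝ}
    (hG : AEMeasurable G ν) (hG0 : ∀ x, 0 ≤ G x) (hk0 : ∀ x, 0 ≤ k x)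
    (hf : ∀ x, f x ≤ G x * k x ^ θ)
    (hk : ∀ a : ℝ, 0 < a → ν {x | a < k x} ≤ ENNReal.ofReal (K / a)) :
    ENNReal.ofReal r * ∫⁻ y in Set.Ioi (0 : ℝ),
        ENNReal.ofReal (y ^ (r - 1)) * ν {x | y < f x} ^ (1 + θ * r)
      ≤ ENNReal.ofReal (2 * (1 + θ * r) * (2 * K) ^ (θ * r)) *
        ∫⁻ x, ENNReal.ofReal (G x ^ r) ∂ν := by
  set m : ℝ → ℝ≥0∞ := fun y => ν {x | y < f x} with hm
  set D : ℝ → ℝ≥0∞ := fun y => ν {x | y < G x} with hD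
  have hm_meas : Measurable m := by
    have : Antitone m := fun a b hab => measure_mono fun x (hx : b < f x) => hab.trans_lt hx
    exact this.measurable
  have hD_meas : Measurable D := by
    have : Antitone D := fun a b hab => measure_mono fun x (hx : b < G x) => hab.trans_lt hx
    exact this.measurable
  have hθr : 0 ≤ θ * r := by positivity
  have hc : 0 ≤ 1 + θ * r := by positivity
  -- comparison of superlevel sets
  have hlevel : ∀ τ y : ℝ, 0 < τ → 0 < y → ENNReal.ofReal τ < m y →
      ENNReal.ofReal (τ / 2) < D (y * (τ / (2 * K)) ^ θ) := by
    intro τ y hτ hy hlt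
    by_contra hcon
    push Not at hcon
    refine absurd hlt (not_lt.2 ?_)
    -- At height `2K/τ` the weak bound gives `k` a superlevel set of measure at most `τ/2`, so at
    -- least half of the mass `τ` must come from `G`.
    have ha : 0 < 2 * K / τ := by positivity
    have hsub : {x | y < f x} ⊆ {x | 2 * K / τ < k x} ∪ {x | y * (τ / (2 * K)) ^ θ < G x} := by
      intro x hx
      have hx : y < f x := hx
      by_contra hnot
      simp only [Set.mem_union, Set.mem_ofPred_eq, not_or, not_lt] at hnot
      have h1 : f x ≤ y * (τ / (2 * K)) ^ θ * (2 * K / τ) ^ θ :=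
        (hf x).trans (mul_le_mul hnot.2 (Real.rpow_le_rpow (hk0 x) hnot.1 hθ.le)
          (Real.rpow_nonneg (hk0 x) _) (by positivity))
      rw [mul_assoc, ← Real.mul_rpow (by positivity) (by positivity)] at h1
      have : τ / (2 * K) * (2 * K / τ) = 1 := by field_simp
      rw [this, Real.one_rpow, mul_one] at h1
      linarith
    calc m y ≤ _ := measure_mono hsub
      _ ≤ _ := measure_union_le _ _
      _ ≤ ENNReal.ofReal (K / (2 * K / τ)) + ENNReal.ofReal (τ / 2) := add_le_add (hk _ ha) hcon
      _ = ENNReal.ofReal τ := by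
        rw [← ENNReal.ofReal_add (by positivity) (by positivity)]
        congr 1
        field_simp
        ring
  -- the inner integral
  have hinner : ∀ τ : ℝ, 0 < τ →
      ∫⁻ y in Set.Ioi (0 : ℝ), ENNReal.ofReal (y ^ (r - 1)) *
        {y : ℝ | ENNReal.ofReal τ < m y}.indicator 1 y ≤
      ENNReal.ofReal ((2 * K) ^ (θ * r) * τ ^ (-(θ * r))) *
        ∫⁻ y in Set.Ioi (0 : ℝ), ENNReal.ofReal (y ^ (r - 1)) *
        {y : ℝ | ENNReal.ofReal (τ / 2) < D y}.indicator 1 y := by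
    intro τ hτ
    have hs : 0 < (τ / (2 * K)) ^ θ := by positivity
    have hsr : ((τ / (2 * K)) ^ θ) ^ (-r) = (2 * K) ^ (θ * r) * τ ^ (-(θ * r)) := by
      rw [← Real.rpow_mul (by positivity), mul_neg, Real.div_rpow hτ.le (by positivity),
        Real.rpow_neg (by positivity : (0 : ℝ) ≤ 2 * K), div_eq_mul_inv, inv_inv, mul_comm]
    rw [← hsr, ← setLIntegral_Ioi_rpow_mul_comp_mul hs
      (fun y => {y : ℝ | ENNReal.ofReal (τ / 2) < D y}.indicator 1 y)]
    refine setLIntegral_mono' measurableSet_Ioi fun y hy => ?_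
    gcongr
    by_cases h : ENNReal.ofReal τ < m y
    · rw [Set.indicator_of_mem (by exact h), Set.indicator_of_mem (by exact hlevel τ y hτ hy h)]
      simp
    · rw [Set.indicator_of_notMem (by exact h)]
      exact zero_le
  have hpow : Measurable fun y : ℝ => ENNReal.ofReal (y ^ (r - 1)) := by fun_prop
  -- measurability on the product
  have hA : Measurable (fun z : ℝ × ℝ => {z : ℝ × ℝ | ENNReal.ofReal z.2 < m z.1}.indicator
      (1 : ℝ × ℝ → ℝ≥0∞) z) :=
    measurable_one.indicator (measurableSet_lt (by fun_prop) (by fun_prop))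
  have hB : Measurable (fun z : ℝ × ℝ => {z : ℝ × ℝ | ENNReal.ofReal (z.1 / 2) < D z.2}.indicator
      (1 : ℝ × ℝ → ℝ≥0∞) z) :=
    measurable_one.indicator (measurableSet_lt (by fun_prop) (by fun_prop))
  have hτmeas : Measurable fun τ : ℝ => ENNReal.ofReal ((1 + θ * r) * τ ^ (θ * r)) := by fun_prop
  have hmain : ∫⁻ y in Set.Ioi (0 : ℝ), ENNReal.ofReal (y ^ (r - 1)) * m y ^ (1 + θ * r) ≤
      ENNReal.ofReal ((1 + θ * r) * (2 * K) ^ (θ * r)) *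
        (2 * ∫⁻ y in Set.Ioi (0 : ℝ), ENNReal.ofReal (y ^ (r - 1)) * D y) := by
    calc _ ≤ ∫⁻ y in Set.Ioi (0 : ℝ), ∫⁻ τ in Set.Ioi (0 : ℝ), ENNReal.ofReal (y ^ (r - 1)) *
            ({z : ℝ × ℝ | ENNReal.ofReal z.2 < m z.1}.indicator (1 : ℝ × ℝ → ℝ≥0∞) (y, τ) *
              ENNReal.ofReal ((1 + θ * r) * τ ^ (θ * r))) := by
          refine lintegral_mono fun y => ?_
          simp only
          rw [lintegral_const_mul' _ _ ENNReal.ofReal_ne_top]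
          gcongr
          refine (rpow_le_lintegral_superlevel hθr (m y)).trans_eq (lintegral_congr fun τ => ?_)
          by_cases h : ENNReal.ofReal τ < m y
          · rw [Set.indicator_of_mem (by exact h), Set.indicator_of_mem (by exact h)]
            simp
          · rw [Set.indicator_of_notMem (by exact h), Set.indicator_of_notMem (by exact h)]
            simp
      _ = ∫⁻ τ in Set.Ioi (0 : ℝ), ∫⁻ y in Set.Ioi (0 : ℝ), ENNReal.ofReal (y ^ (r - 1)) *
            ({z : ℝ × ℝ | ENNReal.ofReal z.2 < m z.1}.indicator (1 : ℝ × ℝ → ℝ≥0∞) (y, τ) *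
              ENNReal.ofReal ((1 + θ * r) * τ ^ (θ * r))) := by
          refine lintegral_lintegral_swap (Measurable.aemeasurable ?_)
          exact (hpow.comp measurable_fst).mul (hA.mul (hτmeas.comp measurable_snd))
      _ ≤ ∫⁻ τ in Set.Ioi (0 : ℝ), ∫⁻ y in Set.Ioi (0 : ℝ),
            ENNReal.ofReal ((1 + θ * r) * (2 * K) ^ (θ * r)) *
            (ENNReal.ofReal (y ^ (r - 1)) *
            {z : ℝ × ℝ | ENNReal.ofReal (z.1 / 2) < D z.2}.indicator (1 : ℝ × ℝ → ℝ≥0∞) (τ, y)) := by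
          -- The dilation produces `τ ^ (-(θ r))`, which cancels the layer-cake density `τ ^ (θ r)`
          -- exactly; what remains integrates in `τ` to `2 D(y)`.
          refine setLIntegral_mono' measurableSet_Ioi fun τ hτ => ?_
          have hτ : 0 < τ := hτ
          calc _ = ENNReal.ofReal ((1 + θ * r) * τ ^ (θ * r)) *
                ∫⁻ y in Set.Ioi (0 : ℝ), ENNReal.ofReal (y ^ (r - 1)) *
                  {y : ℝ | ENNReal.ofReal τ < m y}.indicator 1 y := by
                rw [← lintegral_const_mul' _ _ ENNReal.ofReal_ne_top]
                refine lintegral_congr fun y => ?_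
                rw [mul_comm (ENNReal.ofReal ((1 + θ * r) * τ ^ (θ * r))), mul_assoc]
                rfl
            _ ≤ _ := mul_le_mul_right (hinner τ hτ) _
            _ = _ := by
                rw [lintegral_const_mul' _ _ ENNReal.ofReal_ne_top, ← mul_assoc,
                  ← ENNReal.ofReal_mul (by positivity)]
                congr 2
                rw [Real.rpow_neg hτ.le]
                have := (Real.rpow_pos_of_pos hτ (θ * r)).ne'
                field_simp
      _ = ENNReal.ofReal ((1 + θ * r) * (2 * K) ^ (θ * r)) *
           ∫⁻ y in Set.Ioi (0 : ℝ), ENNReal.ofReal (y ^ (r - 1)) *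
            ∫⁻ τ in Set.Ioi (0 : ℝ), {τ : ℝ | ENNReal.ofReal (τ / 2) < D y}.indicator 1 τ := by
          rw [lintegral_lintegral_swap]
          · rw [← lintegral_const_mul' _ _ ENNReal.ofReal_ne_top]
            refine lintegral_congr fun y => ?_
            rw [lintegral_const_mul' _ _ ENNReal.ofReal_ne_top,
              lintegral_const_mul' _ _ ENNReal.ofReal_ne_top]
            rfl
          · refine Measurable.aemeasurable ?_
            exact ((hpow.comp measurable_snd).mul hB).const_mul _
      _ ≤ _ := by
          gcongr
          rw [← lintegral_const_mul' _ _ (by norm_num)]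
          refine lintegral_mono fun y => ?_
          simp only
          rw [mul_left_comm]
          gcongr
          exact setLIntegral_Ioi_indicator_ofReal_half_lt _
  have hlayer := lintegral_rpow_eq_lintegral_meas_lt_mul ν (Filter.Eventually.of_forall hG0) hG hr
  rw [hlayer]
  calc _ ≤ _ := mul_le_mul_right hmain _
    _ = _ := by
      rw [show (2 : ℝ) * (1 + θ * r) * (2 * K) ^ (θ * r) = 2 * ((1 + θ * r) * (2 * K) ^ (θ * r)) by
        ring, ENNReal.ofReal_mul (by norm_num : (0 : ℝ) ≤ 2), ENNReal.ofReal_ofNat]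
      simp_rw [mul_comm (ENNReal.ofReal (_ ^ (r - 1)))]
      simp only [hD]
      ring

/-! ### Dyadic stopping estimate in a fixed direction. -/

section Doubling

variable {E : Type*} [AddCommGroup E] [Module ℝ E]

/-- The sums `∑ |u (x + (i + 1) e) - u (x + i e)|` over `i < 2 ^ j`, built by doubling. -/
noncomputable def dyadicVariation (u : E → ℝ) (e : E) : ℕ → E → ℝ
  | 0, x => |u (x + e) - u x|
  | j + 1, x => dyadicVariation u e j x + dyadicVariation u e j (x + (2 : ℝ) ^ j • e)

/-- The weighted count of those dyadic subsegments on which the variation exceeds its weight. -/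
noncomputable def dyadicCount (u : E → ℝ) (e : E) (w : ℕ → ℝ) : ℕ → E → ℝ
  | 0, x => {x | w 0 < dyadicVariation u e 0 x}.indicator (fun _ => w 0) x
  | j + 1, x => {x | w (j + 1) < dyadicVariation u e (j + 1) x}.indicator (fun _ => w (j + 1)) x +
      (dyadicCount u e w j x + dyadicCount u e w j (x + (2 : ℝ) ^ j • e))

theorem dyadicVariation_nonneg (u : E → ℝ) (e : E) (j : ℕ) (x : E) :
    0 ≤ dyadicVariation u e j x := by
  induction j generalizing x with
  | zero => exact abs_nonneg _
  | succ j ih => exact add_nonneg (ih _) (ih _)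

theorem abs_sub_le_dyadicVariation (u : E → ℝ) (e : E) (j : ℕ) (x : E) :
    |u (x + (2 : ℝ) ^ j • e) - u x| ≤ dyadicVariation u e j x := by
  induction j generalizing x with
  | zero => simp [dyadicVariation]
  | succ j ih =>
    have h2 : x + (2 : ℝ) ^ (j + 1) • e = x + (2 : ℝ) ^ j • e + (2 : ℝ) ^ j • e := by
      rw [pow_succ, mul_two, add_smul, add_assoc]
    rw [h2]
    calc _ ≤ |u (x + (2 : ℝ) ^ j • e + (2 : ℝ) ^ j • e) - u (x + (2 : ℝ) ^ j • e)|
          + |u (x + (2 : ℝ) ^ j • e) - u x| := abs_sub_le _ _ _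
      _ ≤ _ := by
        rw [add_comm]
        exact add_le_add (ih _) (ih _)

theorem dyadicCount_nonneg (u : E → ℝ) (e : E) {w : ℕ → ℝ} (hw : ∀ j, 0 < w j) (j : ℕ) (x : E) :
    0 ≤ dyadicCount u e w j x := by
  induction j generalizing x with
  | zero => exact Set.indicator_nonneg (fun _ _ => (hw 0).le) _
  | succ j ih =>
    exact add_nonneg (Set.indicator_nonneg (fun _ _ => (hw _).le) _) (add_nonneg (ih _) (ih _))

/-- Even if every node of the tree is counted, the total weight is a geometric series dominated by
the root, which gives the second bound. The two bounds are carried together: at a node that exceeds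
its weight the second implies the first, and elsewhere the first is additive over the children. -/
theorem dyadicCount_le_of_two_lt (u : E → ℝ) (e : E) {w : ℕ → ℝ} (hw : ∀ j, 0 < w j) {ρ : ℝ}
    (hρ : 2 < ρ) (hwρ : ∀ j, w (j + 1) = ρ * w j) (j : ℕ) (x : E) :
    dyadicCount u e w j x ≤ ρ / (ρ - 2) * dyadicVariation u e j x ∧
      dyadicCount u e w j x ≤ ρ / (ρ - 2) * w j := by
  have hA : 1 ≤ ρ / (ρ - 2) := by
    rw [le_div_iff₀ (by linarith)]
    linarith
  induction j generalizing x with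
  | zero =>
    have h0 := hw 0
    have h1 := dyadicVariation_nonneg u e 0 x
    by_cases h : w 0 < dyadicVariation u e 0 x
    · have : dyadicCount u e w 0 x = w 0 := Set.indicator_of_mem (by exact h) _
      rw [this]
      constructor <;> nlinarith
    · have : dyadicCount u e w 0 x = 0 := Set.indicator_of_notMem (by exact h) _
      rw [this]
      constructor <;> positivity
  | succ j ih =>
    obtain ⟨h1, h2⟩ := ih x
    obtain ⟨h3, h4⟩ := ih (x + (2 : ℝ) ^ j • e)
    have h5 : ρ / (ρ - 2) * w (j + 1) = w (j + 1) + 2 * (ρ / (ρ - 2) * w j) := by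
      rw [hwρ]
      have : ρ - 2 ≠ 0 := by linarith
      field_simp
      ring
    have h6 := hw (j + 1)
    have h7 := dyadicVariation_nonneg u e (j + 1) x
    have hv : dyadicVariation u e (j + 1) x =
      dyadicVariation u e j x + dyadicVariation u e j (x + (2 : ℝ) ^ j • e) := rfl
    by_cases h : w (j + 1) < dyadicVariation u e (j + 1) x
    · have : dyadicCount u e w (j + 1) x = w (j + 1) +
          (dyadicCount u e w j x + dyadicCount u e w j (x + (2 : ℝ) ^ j • e)) := by
        rw [dyadicCount, Set.indicator_of_mem (by exact h)]
      rw [this]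
      have h8 : w (j + 1) + (dyadicCount u e w j x + dyadicCount u e w j (x + (2 : ℝ) ^ j • e))
          ≤ ρ / (ρ - 2) * w (j + 1) := by linarith
      exact ⟨h8.trans (mul_le_mul_of_nonneg_left h.le (by linarith)), h8⟩
    · have : dyadicCount u e w (j + 1) x =
          dyadicCount u e w j x + dyadicCount u e w j (x + (2 : ℝ) ^ j • e) := by
        rw [dyadicCount, Set.indicator_of_notMem (by exact h), zero_add]
      rw [this, hv]
      constructor <;> linarith

/-- Weights now decrease towards the root, so a node that does not exceed its weight has no counted
descendant. At an exceeding node the induction keeps a slack `B * w j`, with `B = ρ/(1-ρ)` chosen so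
that `w (j+1) + B * w (j+1) = B * w j`: the slack of one child pays for the parent and for the
parent's own slack. -/
theorem dyadicCount_le_of_lt_one (u : E → ℝ) (e : E) {w : ℕ → ℝ} (hw : ∀ j, 0 < w j) {ρ : ℝ}
    (hρ0 : 0 < ρ) (hρ : ρ < 1) (hwρ : ∀ j, w (j + 1) = ρ * w j) (j : ℕ) (x : E) :
    (w j < dyadicVariation u e j x → dyadicCount u e w j x + ρ / (1 - ρ) * w j ≤
      1 / (1 - ρ) * dyadicVariation u e j x) ∧
      (¬ w j < dyadicVariation u e j x → dyadicCount u e w j x = 0) := by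
  have hρ' : 1 - ρ ≠ 0 := by linarith
  have hA : 1 / (1 - ρ) = 1 + ρ / (1 - ρ) := by
    field_simp
    ring
  have hB : 0 < ρ / (1 - ρ) := div_pos hρ0 (by linarith)
  set B := ρ / (1 - ρ) with hBdef
  rw [hA]
  induction j generalizing x with
  | zero =>
    refine ⟨fun h => ?_, fun h => Set.indicator_of_notMem (by exact h) _⟩
    have : dyadicCount u e w 0 x = w 0 := Set.indicator_of_mem (by exact h) _
    rw [this]
    nlinarith
  | succ j ih =>
    obtain ⟨h1, h2⟩ := ih x
    obtain ⟨h3, h4⟩ := ih (x + (2 : ℝ) ^ j • e)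
    have hv : dyadicVariation u e (j + 1) x =
      dyadicVariation u e j x + dyadicVariation u e j (x + (2 : ℝ) ^ j • e) := rfl
    have hn1 := dyadicVariation_nonneg u e j x
    have hn2 := dyadicVariation_nonneg u e j (x + (2 : ℝ) ^ j • e)
    have hwj := hw j
    have hwlt : w (j + 1) < w j := by
      rw [hwρ]
      nlinarith
    have hBw : w (j + 1) + B * w (j + 1) = B * w j := by
      rw [hwρ, hBdef]
      field_simp
      ring
    constructor
    · intro h
      have : dyadicCount u e w (j + 1) x = w (j + 1) +
          (dyadicCount u e w j x + dyadicCount u e w j (x + (2 : ℝ) ^ j • e)) := by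
        rw [dyadicCount, Set.indicator_of_mem (by exact h)]
      rw [this]
      have hp1 := mul_nonneg hB.le hn1
      have hp2 := mul_nonneg hB.le hn2
      have hp3 := mul_nonneg hB.le hwj.le
      by_cases ha : w j < dyadicVariation u e j x <;>
        by_cases hb : w j < dyadicVariation u e j (x + (2 : ℝ) ^ j • e)
      · have := h1 ha
        have := h3 hb
        rw [hv]
        linarith
      · have := h1 ha
        have := h4 hb
        rw [hv]
        linarith
      · have := h2 ha
        have := h3 hb
        rw [hv]
        linarith
      · rw [h2 ha, h4 hb]
        have := mul_lt_mul_of_pos_left h hB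
        linarith
    · intro h
      rw [dyadicCount, Set.indicator_of_notMem (by exact h), h2 (by intro h'; apply h; rw [hv]; linarith),
        h4 (by intro h'; apply h; rw [hv]; linarith)]
      simp

theorem exists_dyadicCount_le {ρ : ℝ} (hρ0 : 0 < ρ) (hρ : ρ < 1 ∨ 2 < ρ) :
    ∃ A : ℝ, 0 < A ∧ ∀ (u : E → ℝ) (e : E) (w : ℕ → ℝ), (∀ j, 0 < w j) →
      (∀ j, w (j + 1) = ρ * w j) → ∀ (j : ℕ) (x : E),
      dyadicCount u e w j x ≤ A * dyadicVariation u e j x := by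
  rcases hρ with hρ | hρ
  · have hA : 0 < 1 / (1 - ρ) := one_div_pos.2 (by linarith)
    refine ⟨1 / (1 - ρ), hA, fun u e w hw hwρ j x => ?_⟩
    obtain ⟨h1, h2⟩ := dyadicCount_le_of_lt_one u e hw hρ0 hρ hwρ j x
    by_cases h : w j < dyadicVariation u e j x
    · have := h1 h
      have h3 : 0 < ρ / (1 - ρ) * w j := mul_pos (div_pos hρ0 (by linarith)) (hw j)
      linarith
    · rw [h2 h]
      exact mul_nonneg hA.le (dyadicVariation_nonneg u e j x)
  · exact ⟨ρ / (ρ - 2), div_pos hρ0 (by linarith), fun u e w hw hwρ j x =>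
      (dyadicCount_le_of_two_lt u e hw hρ hwρ j x).1⟩

variable [MeasurableSpace E] [MeasurableAdd E]

theorem measurable_dyadicVariation {u : E → ℝ} (hu : Measurable u) (e : E) (j : ℕ) :
    Measurable (dyadicVariation u e j) := by
  induction j with
  | zero =>
    have : Measurable fun x => |u (x + e) - u x| := by
      have := hu.comp (measurable_add_const e)
      exact (this.sub hu).abs
    exact this
  | succ j ih => exact ih.add (ih.comp (measurable_add_const _))

variable (μ : Measure E) [μ.IsAddRightInvariant]

theorem lintegral_dyadicVariation {u : E → ℝ} (hu : Measurable u) (e : E) (j : ℕ) :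
    ∫⁻ x, ENNReal.ofReal (dyadicVariation u e j x) ∂μ
      = 2 ^ j * ∫⁻ x, ENNReal.ofReal |u (x + e) - u x| ∂μ := by
  induction j with
  | zero => simp [dyadicVariation]
  | succ j ih =>
    have hm := (measurable_dyadicVariation hu e j).ennreal_ofReal
    calc _ = ∫⁻ x, (ENNReal.ofReal (dyadicVariation u e j x) +
            ENNReal.ofReal (dyadicVariation u e j (x + (2 : ℝ) ^ j • e))) ∂μ := by
          refine lintegral_congr fun x => ?_
          rw [← ENNReal.ofReal_add (dyadicVariation_nonneg ..) (dyadicVariation_nonneg ..)]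
          rfl
      _ = _ := by
        rw [lintegral_add_left hm, lintegral_add_right_eq_self
          (fun x => ENNReal.ofReal (dyadicVariation u e j x)), ih]
        ring

/-- The tree of height `j` has `2 ^ (j - i)` nodes at level `i`, and by translation invariance all
of them have the same integral. Factoring out `2 ^ j` leaves weights `w i * 2⁻¹ ^ i`. -/
theorem sum_measure_le_lintegral_dyadicCount {u : E → ℝ} (hu : Measurable u) (e : E) {w : ℕ → ℝ}
    (hw : ∀ j, 0 < w j) (j : ℕ) :
    Measurable (dyadicCount u e w j) ∧
    2 ^ j * ∑ i ∈ Finset.range (j + 1), ENNReal.ofReal (w i * (2⁻¹) ^ i) *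
        μ {x | w i < dyadicVariation u e i x}
      = ∫⁻ x, ENNReal.ofReal (dyadicCount u e w j x) ∂μ := by
  have hset : ∀ i, MeasurableSet {x | w i < dyadicVariation u e i x} := fun i =>
    measurableSet_lt measurable_const (measurable_dyadicVariation hu e i)
  have hind : ∀ i, Measurable
      ({x | w i < dyadicVariation u e i x}.indicator (fun _ => w i)) := fun i =>
    measurable_const.indicator (hset i)
  have hlin : ∀ i, ∫⁻ x, ENNReal.ofReal
      ({x | w i < dyadicVariation u e i x}.indicator (fun _ => w i) x) ∂μ =
      ENNReal.ofReal (w i) * μ {x | w i < dyadicVariation u e i x} := by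
    intro i
    rw [← lintegral_indicator_const (hset i)]
    refine lintegral_congr fun x => ?_
    by_cases h : w i < dyadicVariation u e i x
    · rw [Set.indicator_of_mem (by exact h), Set.indicator_of_mem (by exact h)]
    · rw [Set.indicator_of_notMem (by exact h), Set.indicator_of_notMem (by exact h)]
      simp
  induction j with
  | zero =>
    refine ⟨hind 0, ?_⟩
    simp only [pow_zero, zero_add, Finset.range_one, Finset.sum_singleton, mul_one, one_mul]
    exact (hlin 0).symm
  | succ j ih =>
    obtain ⟨hm, ih⟩ := ih
    have hm2 : Measurable fun x => dyadicCount u e w j (x + (2 : ℝ) ^ j • e) :=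
      hm.comp (measurable_add_const _)
    refine ⟨(hind _).add (hm.add hm2), ?_⟩
    have hsplit : ∀ x, ENNReal.ofReal (dyadicCount u e w (j + 1) x) =
        ENNReal.ofReal ({x | w (j + 1) < dyadicVariation u e (j + 1) x}.indicator
          (fun _ => w (j + 1)) x) + (ENNReal.ofReal (dyadicCount u e w j x) +
          ENNReal.ofReal (dyadicCount u e w j (x + (2 : ℝ) ^ j • e))) := by
      intro x
      rw [← ENNReal.ofReal_add (dyadicCount_nonneg u e hw ..) (dyadicCount_nonneg u e hw ..),
        ← ENNReal.ofReal_add (Set.indicator_nonneg (fun _ _ => (hw _).le) _)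
          (add_nonneg (dyadicCount_nonneg u e hw ..) (dyadicCount_nonneg u e hw ..))]
      rfl
    rw [lintegral_congr hsplit, lintegral_add_left (hind _).ennreal_ofReal,
      lintegral_add_left hm.ennreal_ofReal, lintegral_add_right_eq_self
      (fun x => ENNReal.ofReal (dyadicCount u e w j x)), ← ih, hlin,
      Finset.sum_range_succ _ (j + 1), mul_add, ENNReal.ofReal_mul (hw _).le]
    have h2 : (2 : ℝ≥0∞) ^ (j + 1) * ENNReal.ofReal (2⁻¹ ^ (j + 1)) = 1 := by
      rw [ENNReal.ofReal_pow (by norm_num), ← mul_pow, ENNReal.ofReal_inv_of_pos (by norm_num),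
        ENNReal.ofReal_ofNat, ENNReal.mul_inv_cancel (by norm_num) (by norm_num), one_pow]
    rw [add_comm]
    congr 1
    · calc _ = (2 : ℝ≥0∞) ^ (j + 1) * ENNReal.ofReal (2⁻¹ ^ (j + 1)) * (ENNReal.ofReal (w (j + 1)) *
          μ {x | w (j + 1) < dyadicVariation u e (j + 1) x}) := by ring
        _ = _ := by rw [h2, one_mul]
    · rw [pow_succ]
      ring

/-- A doubling estimate for the dyadic differences of a function in a fixed direction. -/
theorem exists_sum_measure_dyadic_le {ρ : ℝ} (hρ0 : 0 < ρ) (hρ : ρ < 1 ∨ 2 < ρ) :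
    ∃ A : ℝ, 0 < A ∧ ∀ (u : E → ℝ) (e : E) (w₀ : ℝ) (M : ℕ), Measurable u → 0 < w₀ →
      ∑ i ∈ Finset.range M, ENNReal.ofReal (w₀ * (ρ / 2) ^ i) *
        μ {x | w₀ * ρ ^ i < |u (x + (2 : ℝ) ^ i • e) - u x|}
      ≤ ENNReal.ofReal A * ∫⁻ x, ENNReal.ofReal |u (x + e) - u x| ∂μ := by
  obtain ⟨A, hA, h⟩ := exists_dyadicCount_le (E := E) hρ0 hρ
  refine ⟨A, hA, fun u e w₀ M hu hw₀ => ?_⟩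
  set w : ℕ → ℝ := fun i => w₀ * ρ ^ i with hw
  have hwpos : ∀ j, 0 < w j := fun j => by positivity
  have hmain : ∑ i ∈ Finset.range (M + 1), ENNReal.ofReal (w i * (2⁻¹) ^ i) *
        μ {x | w i < dyadicVariation u e i x} ≤
        ENNReal.ofReal A * ∫⁻ x, ENNReal.ofReal |u (x + e) - u x| ∂μ := by
    have h1 := (sum_measure_le_lintegral_dyadicCount μ hu e hwpos M).2
    have h2 : ∫⁻ x, ENNReal.ofReal (dyadicCount u e w M x) ∂μ ≤
        2 ^ M * (ENNReal.ofReal A * ∫⁻ x, ENNReal.ofReal |u (x + e) - u x| ∂μ) := by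
      calc _ ≤ ∫⁻ x, ENNReal.ofReal A * ENNReal.ofReal (dyadicVariation u e M x) ∂μ := by
            refine lintegral_mono fun x => ?_
            rw [← ENNReal.ofReal_mul hA.le]
            exact ENNReal.ofReal_le_ofReal
              (h u e w hwpos (fun j => by simp only [hw]; ring) M x)
        _ = _ := by
          rw [lintegral_const_mul' _ _ ENNReal.ofReal_ne_top, lintegral_dyadicVariation μ hu]
          ring
    rw [← h1] at h2
    -- The factor `2 ^ M` occurs on both sides, so it cancels and the constant does not depend on
    -- `M`.
    exact (ENNReal.mul_le_mul_iff_right (by positivity) (by finiteness)).1 h2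
  refine le_trans ?_ hmain
  refine (Finset.sum_le_sum fun i _ => ?_).trans
    (Finset.sum_le_sum_of_subset (Finset.range_mono (Nat.le_succ M)))
  have : w₀ * (ρ / 2) ^ i = w i * 2⁻¹ ^ i := by
    simp only [hw, div_eq_mul_inv, mul_pow]
    ring
  rw [this]
  gcongr
  exact abs_sub_le_dyadicVariation u e i _

end Doubling

/-! ### Duality for the `L^1` norm. -/

section Duality

variable {E : Type*} [NormedAddCommGroup E] [NormedSpace ℝ E] [FiniteDimensional ℝ E]
  [MeasurableSpace E] [BorelSpace E] (μ : Measure E) [μ.IsAddHaarMeasure]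

/-- The `L^1` norm is dual to the supremum norm on compactly supported smooth functions. -/
theorem lintegral_abs_le_of_forall_contDiff {g : E → ℝ} (hg : LocallyIntegrable g μ) {C : ℝ≥0∞}
    (h : ∀ ψ : E → ℝ, ContDiff ℝ 1 ψ → HasCompactSupport ψ → (∀ x, |ψ x| ≤ 1) →
      ENNReal.ofReal |∫ x, g x * ψ x ∂μ| ≤ C) :
    ∫⁻ x, ENNReal.ofReal |g x| ∂μ ≤ C := by
  have hball : ∀ R : ℕ, ∫⁻ x in Metric.ball 0 (R : ℝ), ENNReal.ofReal |g x| ∂μ ≤ C := by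
    intro R
    set B := Metric.ball (0 : E) (R : ℝ) with hB
    -- This is the sign of `g` on the ball (with `0 / 0 = 0`); its mollifications are the admissible
    -- test functions.
    set f : E → ℝ := B.indicator (fun x => g x / |g x|) with hf
    have hgm : AEMeasurable g μ := hg.aestronglyMeasurable.aemeasurable
    have hf1 : ∀ x, |f x| ≤ 1 := by
      intro x
      by_cases hx : x ∈ B
      · rw [hf, Set.indicator_of_mem hx, abs_div, abs_abs]
        exact div_self_le_one _
      · rw [hf, Set.indicator_of_notMem hx]
        simp
    have hfm : AEStronglyMeasurable f μ :=
      ((hgm.div hgm.abs).indicator measurableSet_ball).aestronglyMeasurable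
    have hfint : Integrable f μ := by
      have : IntegrableOn (fun _ : E => (1 : ℝ)) B μ :=
        integrableOn_const (measure_ball_lt_top).ne
      refine (this.integrable_indicator measurableSet_ball).mono' hfm
        (Filter.Eventually.of_forall fun x => ?_)
      by_cases hx : x ∈ B
      · rw [Set.indicator_of_mem hx]
        exact hf1 x
      · rw [Set.indicator_of_notMem hx, hf, Set.indicator_of_notMem hx]
        simp
    -- The ratio of outer to inner radius stays equal to `2`; a bounded ratio is what almost
    -- everywhere convergence of the mollifications requires.
    let φ : ℕ → ContDiffBump (0 : E) := fun i =>
      ⟨1 / (2 * ((i : ℝ) + 1)), 1 / ((i : ℝ) + 1), by positivity, by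
        apply one_div_lt_one_div_of_lt <;> linarith [(Nat.cast_nonneg i : (0 : ℝ) ≤ i)]⟩
    have hφ0 : Filter.Tendsto (fun i => (φ i).rOut) Filter.atTop (nhds 0) :=
      tendsto_one_div_add_atTop_nhds_zero_nat
    have hφ1 : ∀ i, (φ i).rOut ≤ 1 := by
      intro i
      change 1 / ((i : ℝ) + 1) ≤ 1
      rw [div_le_one (by positivity)]
      linarith [(Nat.cast_nonneg i : (0 : ℝ) ≤ i)]
    set ψ : ℕ → E → ℝ := fun i =>
      convolution ((φ i).normed μ) f (ContinuousLinearMap.lsmul ℝ ℝ) μ with hψ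
    have hψlim : ∀ᵐ x ∂μ, Filter.Tendsto (fun i => ψ i x) Filter.atTop (nhds (f x)) :=
      ContDiffBump.ae_convolution_tendsto_right_of_locallyIntegrable (K := 2) hφ0
        (Filter.Eventually.of_forall fun i => by
          change 1 / ((i : ℝ) + 1) ≤ 2 * (1 / (2 * ((i : ℝ) + 1)))
          apply le_of_eq
          field_simp) hfint.locallyIntegrable
    have hψsupp : ∀ i, Function.support (ψ i) ⊆ Metric.closedBall 0 ((R : ℝ) + 1) := by
      intro i x hx
      obtain ⟨a, ha, b, hb, rfl⟩ := (support_convolution_subset _ hx)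
      rw [(φ i).support_normed_eq] at ha
      have hb : b ∈ B := by
        by_contra hb'
        exact hb (by rw [hf, Set.indicator_of_notMem hb'])
      rw [mem_ball_zero_iff] at ha hb
      rw [mem_closedBall_zero_iff]
      have := norm_add_le a b
      have := hφ1 i
      linarith
    have hψcs : ∀ i, HasCompactSupport (ψ i) := fun i =>
      HasCompactSupport.of_support_subset_isCompact (isCompact_closedBall _ _) (hψsupp i)
    have hψC : ∀ i, ContDiff ℝ 1 (ψ i) := fun i =>
      (φ i).hasCompactSupport_normed.contDiff_convolution_left _ (φ i).contDiff_normed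
        hfint.locallyIntegrable
    have hψ1 : ∀ i x, |ψ i x| ≤ 1 := by
      intro i x
      rw [hψ, ← Real.norm_eq_abs, ← (φ i).integral_normed (μ := μ)]
      refine norm_integral_le_of_norm_le (φ i).integrable_normed
        (Filter.Eventually.of_forall fun t => ?_)
      simp only [ContinuousLinearMap.lsmul_apply, smul_eq_mul, norm_mul, Real.norm_eq_abs]
      rw [abs_of_nonneg ((φ i).nonneg_normed t)]
      exact mul_le_of_le_one_right ((φ i).nonneg_normed t) (hf1 _)
    have hlim : Filter.Tendsto (fun i => ∫ x, g x * ψ i x ∂μ) Filter.atTop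
        (nhds (∫ x, g x * f x ∂μ)) := by
      refine tendsto_integral_of_dominated_convergence
        ((Metric.closedBall (0 : E) ((R : ℝ) + 1)).indicator fun x => |g x|)
        (fun i => hg.aestronglyMeasurable.mul (hψC i).continuous.aestronglyMeasurable) ?_ ?_ ?_
      · rw [integrable_indicator_iff measurableSet_closedBall]
        exact (hg.integrableOn_isCompact (isCompact_closedBall _ _)).abs
      · intro i
        refine Filter.Eventually.of_forall fun x => ?_
        by_cases hx : x ∈ Metric.closedBall (0 : E) ((R : ℝ) + 1)
        · rw [Set.indicator_of_mem hx, norm_mul, Real.norm_eq_abs, Real.norm_eq_abs]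
          exact mul_le_of_le_one_right (abs_nonneg _) (hψ1 i x)
        · rw [Set.indicator_of_notMem hx]
          have : ψ i x = 0 := by
            by_contra hne
            exact hx (hψsupp i hne)
          simp [this]
      · filter_upwards [hψlim] with x hx using hx.const_mul _
    have hgf : (fun x => g x * f x) = B.indicator fun x => |g x| := by
      ext x
      by_cases hx : x ∈ B
      · rw [hf, Set.indicator_of_mem hx, Set.indicator_of_mem hx]
        rcases eq_or_ne (g x) 0 with h0 | h0
        · simp [h0]
        · rw [← mul_div_assoc, ← abs_mul_abs_self (g x), mul_div_assoc,
            div_self (abs_ne_zero.2 h0), mul_one]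
      · rw [hf, Set.indicator_of_notMem hx, Set.indicator_of_notMem hx, mul_zero]
    have hle : ENNReal.ofReal |∫ x, g x * f x ∂μ| ≤ C :=
      le_of_tendsto ((ENNReal.continuous_ofReal.tendsto _).comp hlim.abs)
        (Filter.Eventually.of_forall fun i => h (ψ i) (hψC i) (hψcs i) (hψ1 i))
    refine le_trans (le_of_eq ?_) hle
    rw [hgf, integral_indicator measurableSet_ball,
      abs_of_nonneg (integral_nonneg fun x => abs_nonneg _),
      ofReal_integral_eq_lintegral_ofReal]
    · exact ((hg.integrableOn_isCompact (isCompact_closedBall (0 : E) R)).mono_set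
        Metric.ball_subset_closedBall).abs
    · exact Filter.Eventually.of_forall fun x => abs_nonneg _
  rw [← setLIntegral_univ, ← Metric.iUnion_ball_nat (0 : E), setLIntegral_iUnion_of_directed]
  · exact iSup_le hball
  · exact Monotone.directed_le fun a b hab => Metric.ball_subset_ball (by exact_mod_cast hab)

end Duality

/-! ### Translations of `BV` functions in `L^1`. -/

section SegmentAverage

variable {E : Type*} [NormedAddCommGroup E] [NormedSpace ℝ E]

/-- The average of `ψ` over the segment from `x - h` to `x`. -/
noncomputable def segmentAverage (ψ : E → ℝ) (h x : E) : ℝ := ∫ τ in (0 : ℝ)..1, ψ (x - τ • h)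

theorem abs_segmentAverage_le {ψ : E → ℝ} (hψ : ∀ x, |ψ x| ≤ 1) (h x : E) :
    |segmentAverage ψ h x| ≤ 1 := by
  have := intervalIntegral.norm_integral_le_of_norm_le_const (a := (0 : ℝ)) (b := 1)
    (f := fun τ : ℝ => ψ (x - τ • h)) (C := 1) (fun τ _ => hψ _)
  simpa [segmentAverage] using this

theorem hasCompactSupport_segmentAverage {ψ : E → ℝ} (hψ : HasCompactSupport ψ) (h : E) :
    HasCompactSupport (segmentAverage ψ h) := by
  have hK : IsCompact ((fun z : E × ℝ => z.1 + z.2 • h) '' (tsupport ψ ×ˢ Set.Icc (0 : ℝ) 1)) :=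
    (hψ.isCompact.prod isCompact_Icc).image (by fun_prop)
  refine HasCompactSupport.intro hK fun x hx => ?_
  have : ∀ τ ∈ Set.uIcc (0 : ℝ) 1, ψ (x - τ • h) = 0 := by
    intro τ hτ
    rw [Set.uIcc_of_le zero_le_one] at hτ
    by_contra hne
    exact hx ⟨(x - τ • h, τ), ⟨subset_tsupport _ hne, hτ⟩, by simp⟩
  rw [segmentAverage, intervalIntegral.integral_congr this]
  simp

theorem hasFDerivAt_segmentAverage {ψ : E → ℝ} (hψ : ContDiff ℝ 1 ψ) (hc : HasCompactSupport ψ)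
    (h x : E) :
    HasFDerivAt (segmentAverage ψ h) (∫ τ in (0 : ℝ)..1, fderiv ℝ ψ (x - τ • h)) x := by
  have hcont : Continuous (fderiv ℝ ψ) := hψ.continuous_fderiv one_ne_zero
  obtain ⟨C, hC⟩ := (hc.fderiv (𝕜 := ℝ)).exists_bound_of_continuous hcont
  have hψc := hψ.continuous
  refine intervalIntegral.hasFDerivAt_integral_of_dominated_of_fderiv_le
    (F := fun x τ => ψ (x - τ • h)) (F' := fun x τ => fderiv ℝ ψ (x - τ • h))
    (bound := fun _ => C) Filter.univ_mem ?_ ?_ ?_ ?_ ?_ ?_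
  · exact Filter.Eventually.of_forall fun y =>
      (by fun_prop : Continuous fun τ : ℝ => ψ (y - τ • h)).aestronglyMeasurable
  · exact (by fun_prop : Continuous fun τ : ℝ => ψ (x - τ • h)).intervalIntegrable _ _
  · exact (by fun_prop : Continuous fun τ : ℝ => fderiv ℝ ψ (x - τ • h)).aestronglyMeasurable
  · exact Filter.Eventually.of_forall fun τ _ y _ => hC _
  · exact continuous_const.intervalIntegrable _ _
  · refine Filter.Eventually.of_forall fun τ _ y _ => ?_
    have h1 := ((hψ.differentiable one_ne_zero) (y - τ • h)).hasFDerivAt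
    exact h1.comp y ((hasFDerivAt_id y).sub_const _)

theorem contDiff_segmentAverage {ψ : E → ℝ} (hψ : ContDiff ℝ 1 ψ) (hc : HasCompactSupport ψ)
    (h : E) : ContDiff ℝ 1 (segmentAverage ψ h) := by
  rw [contDiff_one_iff_hasFDerivAt]
  refine ⟨_, ?_, hasFDerivAt_segmentAverage hψ hc h⟩
  have hcont : Continuous (fderiv ℝ ψ) := hψ.continuous_fderiv one_ne_zero
  apply intervalIntegral.continuous_parametric_intervalIntegral_of_continuous'
  fun_prop

/-- The fundamental theorem of calculus along the segment. It exhibits a finite difference of `ψ` as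
a directional derivative, hence as a divergence. -/
theorem fderiv_segmentAverage_apply {ψ : E → ℝ} (hψ : ContDiff ℝ 1 ψ) (hc : HasCompactSupport ψ)
    (h x : E) : fderiv ℝ (segmentAverage ψ h) x h = ψ x - ψ (x - h) := by
  have hcont : Continuous (fderiv ℝ ψ) := hψ.continuous_fderiv one_ne_zero
  rw [(hasFDerivAt_segmentAverage hψ hc h x).fderiv, ContinuousLinearMap.intervalIntegral_apply
    ((by fun_prop : Continuous fun τ : ℝ => fderiv ℝ ψ (x - τ • h)).intervalIntegrable _ _)]
  have hder : ∀ τ ∈ Set.uIcc (0 : ℝ) 1,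
      HasDerivAt (fun τ : ℝ => - ψ (x - τ • h)) (fderiv ℝ ψ (x - τ • h) h) τ := by
    intro τ _
    have h1 := ((hψ.differentiable one_ne_zero) (x - τ • h)).hasFDerivAt
    have h2 : HasDerivAt (fun τ : ℝ => x - τ • h) (-h) τ := by
      simpa using ((hasDerivAt_id τ).smul_const h).const_sub x
    have h3 := (h1.comp_hasDerivAt τ h2).neg
    rw [map_neg, neg_neg] at h3
    exact h3
  rw [intervalIntegral.integral_eq_sub_of_hasDerivAt hder
    ((by fun_prop : Continuous fun τ : ℝ => fderiv ℝ ψ (x - τ • h) h).intervalIntegrable _ _)]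
  simp
  ring

end SegmentAverage

theorem divergence_smul_const {n : ℕ} {Φ : EuclideanSpace ℝ (Fin n) → ℝ}
    {x : EuclideanSpace ℝ (Fin n)} (hΦ : DifferentiableAt ℝ Φ x) (v : EuclideanSpace ℝ (Fin n)) :
    divergence (fun y => Φ y • v) x = fderiv ℝ Φ x v := by
  have hv : v = ∑ i, v i • EuclideanSpace.single i (1 : ℝ) := by
    have := (EuclideanSpace.basisFun (Fin n) ℝ).sum_repr v
    simpa using this.symm
  have h1 : fderiv ℝ (fun y => Φ y • v) x = (fderiv ℝ Φ x).smulRight v :=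
    (hΦ.hasFDerivAt.smul_const v).fderiv
  conv_rhs => rw [hv, map_sum]
  simp only [divergence, h1, ContinuousLinearMap.smulRight_apply, PiLp.smul_apply, smul_eq_mul,
    map_smul]
  exact Finset.sum_congr rfl fun i _ => mul_comm _ _

/-- Translations of a function of bounded variation are Lipschitz in `L^1`. -/
theorem lintegral_abs_sub_translate_le_bvNorm {n : ℕ} {u : EuclideanSpace ℝ (Fin n) → ℝ}
    (hu : LocallyIntegrable u volume) (h : EuclideanSpace ℝ (Fin n)) :
    ∫⁻ x, ENNReal.ofReal |u (x + h) - u x| ≤ ENNReal.ofReal ‖h‖ * bvNorm u := by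
  rcases eq_or_ne h 0 with rfl | hh
  · simp
  have hn : 0 < ‖h‖ := norm_pos_iff.2 hh
  have hmp := measurePreserving_add_right (volume : Measure (EuclideanSpace ℝ (Fin n))) h
  have hut : LocallyIntegrable (fun x => u (x + h)) volume := by
    rw [locallyIntegrable_iff]
    intro K hK
    have h1 := hu.integrableOn_isCompact (hK.image (continuous_add_const h))
    have h2 := hmp.integrableOn_comp_preimage (Homeomorph.addRight h).measurableEmbedding
      (f := u) (s := (fun x => x + h) '' K)
    rw [Set.preimage_image_eq _ (add_left_injective h)] at h2
    exact h2.2 h1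
  refine lintegral_abs_le_of_forall_contDiff volume (hut.sub hu) fun ψ hψ hc hψ1 => ?_
  have hi1 : Integrable (fun x => u x * ψ x) volume := by
    simpa [mul_comm] using hu.integrable_smul_left_of_hasCompactSupport hψ.continuous hc
  have hi2 : Integrable (fun x => u (x + h) * ψ x) volume := by
    simpa [mul_comm] using hut.integrable_smul_left_of_hasCompactSupport hψ.continuous hc
  have hi3 : Integrable (fun x => u x * ψ (x - h)) volume := by
    have := (measurePreserving_sub_right volume h).integrable_comp_of_integrable hi2
    simpa [Function.comp_def] using this
  have heq : ∫ x, u (x + h) * ψ x = ∫ x, u x * ψ (x - h) := by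
    have := integral_add_right_eq_self (μ := volume) (fun x => u x * ψ (x - h)) h
    simpa using this
  -- This field is admissible for the total variation, and `‖h‖` times its divergence is `ψ x - ψ (x
  -- - h)`; moving the translation from `u` to `ψ` then finishes the proof.
  set φ : EuclideanSpace ℝ (Fin n) → EuclideanSpace ℝ (Fin n) :=
    fun x => segmentAverage ψ h x • (‖h‖⁻¹ • h) with hφ
  have hφC : ContDiff ℝ 1 φ := (contDiff_segmentAverage hψ hc h).smul contDiff_const
  have hφc : HasCompactSupport φ := (hasCompactSupport_segmentAverage hc h).smul_right
  have hφ1 : ∀ x, ‖φ x‖ ≤ 1 := by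
    intro x
    rw [hφ, norm_smul, norm_smul, norm_inv, norm_norm, inv_mul_cancel₀ hn.ne', mul_one]
    exact abs_segmentAverage_le hψ1 h x
  have hdiv : ∀ x, divergence φ x = ‖h‖⁻¹ * (ψ x - ψ (x - h)) := by
    intro x
    rw [hφ, divergence_smul_const (hasFDerivAt_segmentAverage hψ hc h x).differentiableAt,
      map_smul, fderiv_segmentAverage_apply hψ hc, smul_eq_mul]
  have hle : ENNReal.ofReal |∫ x, u x * divergence φ x| ≤ bvNorm u :=
    le_iSup_of_le φ <| le_iSup_of_le hφC <| le_iSup_of_le hφc <| le_iSup_of_le hφ1 le_rfl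
  have hint : ∫ x, (u (x + h) - u x) * ψ x = -(‖h‖ * ∫ x, u x * divergence φ x) := by
    calc _ = ∫ x, (u (x + h) * ψ x - u x * ψ x) := by simp_rw [sub_mul]
      _ = ∫ x, (u x * ψ (x - h) - u x * ψ x) := by
        rw [integral_sub hi2 hi1, integral_sub hi3 hi1, heq]
      _ = _ := by
        rw [← integral_const_mul, ← integral_neg]
        refine integral_congr_ae (Filter.Eventually.of_forall fun x => ?_)
        simp only [hdiv]
        field_simp
        ring
  change ENNReal.ofReal |∫ x, (u (x + h) - u x) * ψ x| ≤ _
  rw [hint, abs_neg, abs_mul, abs_of_pos hn, ENNReal.ofReal_mul hn.le]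
  gcongr

/-! ### Decomposition into dilated annuli. -/

section Annuli

variable {E : Type*} [NormedAddCommGroup E] [NormedSpace ℝ E] [FiniteDimensional ℝ E]
  [MeasurableSpace E] [BorelSpace E] (μ : Measure E) [μ.IsAddHaarMeasure]

theorem lintegral_comp_smul_addHaar (f : E → ℝ≥0∞) {c : ℝ} (hc : 0 < c) :
    ∫⁻ x, f x ∂μ =
      ENNReal.ofReal (c ^ Module.finrank ℝ E) * ∫⁻ x, f (c • x) ∂μ := by
  have h1 : ∫⁻ x, f (c • x) ∂μ = ∫⁻ x, f x ∂(μ.map (c • ·)) :=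
    ((Homeomorph.smulOfNeZero c hc.ne').measurableEmbedding.lintegral_map f).symm
  rw [h1, Measure.map_addHaar_smul μ hc.ne', lintegral_smul_measure, abs_of_pos (by positivity),
    smul_eq_mul, ← mul_assoc, ← ENNReal.ofReal_mul (by positivity),
    mul_inv_cancel₀ (by positivity), ENNReal.ofReal_one, one_mul]

/-- Decomposition of an integral over dilates of the annulus `1 ≤ ‖x‖ < b`. -/
theorem lintegral_eq_lintegral_annulus_tsum [Nontrivial E] {Ψ : E → ℝ≥0∞} (hΨ : Measurable Ψ)
    {b : ℝ} (hb : 1 < b) :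
    ∫⁻ x, Ψ x ∂μ = ∫⁻ x in {x : E | ‖x‖ ∈ Set.Ico 1 b}, ∑' k : ℤ,
      ENNReal.ofReal ((b ^ k) ^ Module.finrank ℝ E) * Ψ (b ^ k • x) ∂μ := by
  have hb0 : 0 < b := by linarith
  set A : ℤ → Set E := fun k => {x | ‖x‖ ∈ Set.Ico (b ^ k) (b ^ (k + 1))} with hA
  have hAm : ∀ k, MeasurableSet (A k) := fun k => measurable_norm measurableSet_Ico
  have hAm1 : MeasurableSet {x : E | ‖x‖ ∈ Set.Ico 1 b} := measurable_norm measurableSet_Ico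
  have hU : (⋃ k, A k) = {0}ᶜ := by
    ext x
    simp only [Set.mem_iUnion, Set.mem_compl_iff, Set.mem_singleton_iff]
    constructor
    · rintro ⟨k, hk⟩ rfl
      have h1 : b ^ k ≤ ‖(0 : E)‖ := hk.1
      rw [norm_zero] at h1
      exact absurd h1 (not_le.2 (by positivity))
    · intro hx
      exact exists_mem_Ico_zpow (norm_pos_iff.2 hx) hb
  have hdisj : Pairwise (Function.onFun Disjoint A) := by
    refine (pairwise_disjoint_on A).2 fun i j hij => Set.disjoint_left.2 fun x hi hj => ?_
    have h1 : b ^ (i + 1) ≤ b ^ j := zpow_le_zpow_right₀ hb.le hij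
    have h2 : ‖x‖ < b ^ (i + 1) := hi.2
    have h3 : b ^ j ≤ ‖x‖ := hj.1
    linarith
  have h0 : ∫⁻ x, Ψ x ∂μ = ∫⁻ x in ⋃ k, A k, Ψ x ∂μ := by
    have hae : ∀ᵐ x ∂μ, x ∈ ({0}ᶜ : Set E) := compl_mem_ae_iff.2 (measure_singleton (0 : E))
    rw [hU, Measure.restrict_eq_self_of_ae_mem hae]
  rw [h0, lintegral_iUnion hAm hdisj, lintegral_tsum]
  · refine tsum_congr fun k => ?_
    have hk : 0 < b ^ k := by positivity
    rw [← lintegral_indicator (hAm k), lintegral_comp_smul_addHaar μ _ hk,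
      lintegral_const_mul' _ _ ENNReal.ofReal_ne_top, ← lintegral_indicator hAm1]
    congr 2
    ext x
    have hiff : b ^ k • x ∈ A k ↔ x ∈ {x : E | ‖x‖ ∈ Set.Ico 1 b} := by
      simp only [hA, Set.mem_ofPred_eq, Set.mem_Ico, norm_smul, Real.norm_eq_abs, abs_of_pos hk]
      rw [zpow_add₀ hb0.ne', zpow_one, le_mul_iff_one_le_right hk, mul_lt_mul_iff_right₀ hk]
    by_cases h : x ∈ {x : E | ‖x‖ ∈ Set.Ico 1 b}
    · rw [Set.indicator_of_mem h, Set.indicator_of_mem (hiff.2 h)]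
    · rw [Set.indicator_of_notMem h, Set.indicator_of_notMem (fun h' => h (hiff.1 h'))]
  · intro k
    exact ((hΨ.comp (measurable_const_smul _)).const_mul _).aemeasurable

end Annuli

/-- Every finite set of integers lies in a window. Windows are the right test sets, since the
doubling estimate climbs from an arbitrary smallest scale. -/
theorem ENNReal.tsum_int_le_of_sum_range_le {f : ℤ → ℝ≥0∞} {c : ℝ≥0∞}
    (h : ∀ (k₀ : ℤ) (M : ℕ), ∑ i ∈ Finset.range M, f (k₀ + i) ≤ c) : ∑' k, f k ≤ c := by
  rw [ENNReal.tsum_eq_iSup_sum]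
  refine iSup_le fun s => ?_
  obtain ⟨K, hK⟩ : ∃ K : ℕ, ∀ k ∈ s, k.natAbs < K :=
    ⟨s.sup Int.natAbs + 1, fun k hk => Nat.lt_succ_of_le (Finset.le_sup (f := Int.natAbs) hk)⟩
  refine le_trans ?_ (h (-K) (2 * K))
  rw [← Finset.sum_image (f := f) (g := fun i : ℕ => -(K : ℤ) + i)
    (fun a _ b _ hab => by simpa using hab)]
  refine Finset.sum_le_sum_of_subset fun k hk => ?_
  have := hK k hk
  rw [Finset.mem_image]
  exact ⟨(k + K).toNat, Finset.mem_range.2 (by omega), by omega⟩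

/-! ### The weak `L^1` bound for quotients of order `1 + γ`. -/

section WeakType

variable {n : ℕ}

theorem measurable_diffQuot {u : EuclideanSpace ℝ (Fin n) → ℝ} (hu : Measurable u) (b : ℝ) :
    Measurable (diffQuot b u) := by
  unfold diffQuot
  have h1 : Measurable fun z : EuclideanSpace ℝ (Fin n) × EuclideanSpace ℝ (Fin n) =>
      u (z.1 + z.2) := hu.comp (by fun_prop)
  have h2 : Measurable fun z : EuclideanSpace ℝ (Fin n) × EuclideanSpace ℝ (Fin n) =>
      u z.1 := hu.comp measurable_fst
  have h3 : Measurable fun z : EuclideanSpace ℝ (Fin n) × EuclideanSpace ℝ (Fin n) =>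
      ‖z.2‖ ^ b := by fun_prop
  exact (h1.sub h2).abs.div h3

theorem diffQuot_nonneg (b : ℝ) (u : EuclideanSpace ℝ (Fin n) → ℝ)
    (z : EuclideanSpace ℝ (Fin n) × EuclideanSpace ℝ (Fin n)) : 0 ≤ diffQuot b u z :=
  div_nonneg (abs_nonneg _) (Real.rpow_nonneg (norm_nonneg _) _)

theorem nuMeasure_apply (γ : ℝ) {S : Set (EuclideanSpace ℝ (Fin n) × EuclideanSpace ℝ (Fin n))}
    (hS : MeasurableSet S) :
    nuMeasure n γ S = ∫⁻ h : EuclideanSpace ℝ (Fin n), ENNReal.ofReal (‖h‖ ^ (γ - (n : ℝ))) *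
      volume {x : EuclideanSpace ℝ (Fin n) | (x, h) ∈ S} := by
  have hw : Measurable fun z : EuclideanSpace ℝ (Fin n) × EuclideanSpace ℝ (Fin n) =>
      ENNReal.ofReal (‖z.2‖ ^ (γ - (n : ℝ))) := by fun_prop
  rw [nuMeasure, withDensity_apply _ hS, ← lintegral_indicator hS,
    lintegral_prod_symm _ (hw.indicator hS).aemeasurable]
  refine lintegral_congr fun h => ?_
  have hSh : MeasurableSet {x : EuclideanSpace ℝ (Fin n) | (x, h) ∈ S} :=
    measurable_prodMk_right hS
  rw [← lintegral_indicator_const hSh]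
  rfl

theorem measurable_weight_mul_section (γ : ℝ)
    {S : Set (EuclideanSpace ℝ (Fin n) × EuclideanSpace ℝ (Fin n))} (hS : MeasurableSet S) :
    Measurable fun h : EuclideanSpace ℝ (Fin n) => ENNReal.ofReal (‖h‖ ^ (γ - (n : ℝ))) *
      volume {x : EuclideanSpace ℝ (Fin n) | (x, h) ∈ S} := by
  have hw : Measurable fun h : EuclideanSpace ℝ (Fin n) =>
      ENNReal.ofReal (‖h‖ ^ (γ - (n : ℝ))) := by fun_prop
  exact hw.mul (measurable_measure_prodMk_right hS)

/-- For `γ ∉ [-1, 0]` the difference quotients of order `1 + γ` of a function of bounded variation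
are in weak `L^1` with respect to `nuMeasure n γ`. -/
theorem exists_nuMeasure_diffQuot_le (hn : 1 ≤ n) {γ : ℝ} (hγ : γ ∉ Set.Icc (-1 : ℝ) 0) :
    ∃ W : ℝ, 0 < W ∧ ∀ u : EuclideanSpace ℝ (Fin n) → ℝ, Measurable u →
      LocallyIntegrable u volume → ∀ a : ℝ, 0 < a →
      nuMeasure n γ {z | a < diffQuot (1 + γ) u z} ≤ ENNReal.ofReal (W / a) * bvNorm u := by
  have : NeZero n := ⟨by omega⟩
  have : Nontrivial (EuclideanSpace ℝ (Fin n)) := inferInstance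
  have hρ0 : (0 : ℝ) < 2 ^ (1 + γ) := by positivity
  -- This dichotomy is where `γ ∉ [-1,0]` enters: `γ < -1` or `γ > 0`.
  have hρ : (2 : ℝ) ^ (1 + γ) < 1 ∨ 2 < (2 : ℝ) ^ (1 + γ) := by
    rw [Set.mem_Icc, not_and_or, not_le, not_le] at hγ
    rcases hγ with h | h
    · left
      exact Real.rpow_lt_one_of_one_lt_of_neg one_lt_two (by linarith)
    · right
      conv_lhs => rw [← Real.rpow_one 2]
      exact Real.rpow_lt_rpow_of_exponent_lt one_lt_two (by linarith)
  obtain ⟨A, hA, hAu⟩ := exists_sum_measure_dyadic_le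
    (volume : Measure (EuclideanSpace ℝ (Fin n))) hρ0 hρ
  set An : Set (EuclideanSpace ℝ (Fin n)) := {x | ‖x‖ ∈ Set.Ico 1 2} with hAn
  have hAnm : MeasurableSet An := measurable_norm measurableSet_Ico
  have hAnfin : volume An < ⊤ :=
    (measure_mono fun x hx => by
      rw [mem_ball_zero_iff]
      exact hx.2).trans_lt (measure_ball_lt_top (x := (0 : EuclideanSpace ℝ (Fin n))) (r := 2))
  refine ⟨A * ((volume An).toReal + 1), by positivity, fun u hu hui a ha => ?_⟩
  have hS : MeasurableSet {z | a < diffQuot (1 + γ) u z} :=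
    measurableSet_lt measurable_const (measurable_diffQuot hu _)
  rw [nuMeasure_apply γ hS, lintegral_eq_lintegral_annulus_tsum volume
    (measurable_weight_mul_section γ hS) one_lt_two]
  have hpt : ∀ h ∈ An, ∑' k : ℤ,
      ENNReal.ofReal (((2 : ℝ) ^ k) ^ Module.finrank ℝ (EuclideanSpace ℝ (Fin n))) *
      (ENNReal.ofReal (‖(2 : ℝ) ^ k • h‖ ^ (γ - (n : ℝ))) *
      volume {x | (x, (2 : ℝ) ^ k • h) ∈ {z | a < diffQuot (1 + γ) u z}}) ≤
      ENNReal.ofReal (A / a) * bvNorm u := by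
    intro h hh
    have hh1 : 1 ≤ ‖h‖ := hh.1
    have hh0 : 0 < ‖h‖ := by linarith
    refine ENNReal.tsum_int_le_of_sum_range_le fun k₀ M => ?_
    have h2k : (0 : ℝ) < 2 ^ k₀ := by positivity
    -- The initial weight is the threshold `a * ‖e‖ ^ (1 + γ)` at the smallest step `e = 2 ^ k₀ •
    -- h`; doubling the step multiplies it by `2 ^ (1 + γ)`.
    have hmain := hAu u ((2 : ℝ) ^ k₀ • h) (a * ((2 : ℝ) ^ k₀ * ‖h‖) ^ (1 + γ)) M hu
      (by positivity)
    have hterm : ∀ i ∈ Finset.range M,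
        ENNReal.ofReal (((2 : ℝ) ^ (k₀ + (i : ℤ))) ^
          Module.finrank ℝ (EuclideanSpace ℝ (Fin n))) *
        (ENNReal.ofReal (‖(2 : ℝ) ^ (k₀ + (i : ℤ)) • h‖ ^ (γ - (n : ℝ))) *
        volume {x | (x, (2 : ℝ) ^ (k₀ + (i : ℤ)) • h) ∈ {z | a < diffQuot (1 + γ) u z}}) =
        ENNReal.ofReal (a⁻¹ * ((2 : ℝ) ^ k₀)⁻¹ * (‖h‖ ^ n)⁻¹ * ‖h‖⁻¹) *
        (ENNReal.ofReal (a * ((2 : ℝ) ^ k₀ * ‖h‖) ^ (1 + γ) * ((2 : ℝ) ^ (1 + γ) / 2) ^ i) *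
        volume {x | a * ((2 : ℝ) ^ k₀ * ‖h‖) ^ (1 + γ) * ((2 : ℝ) ^ (1 + γ)) ^ i <
          |u (x + (2 : ℝ) ^ i • (2 : ℝ) ^ k₀ • h) - u x|}) := by
      intro i _
      have hsm : (2 : ℝ) ^ (k₀ + (i : ℤ)) • h = (2 : ℝ) ^ i • (2 : ℝ) ^ k₀ • h := by
        rw [smul_smul, zpow_add₀ two_ne_zero, zpow_natCast, mul_comm]
      have hnorm : ‖(2 : ℝ) ^ (k₀ + (i : ℤ)) • h‖ = 2 ^ i * (2 ^ k₀ * ‖h‖) := by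
        rw [hsm, norm_smul, norm_smul, Real.norm_of_nonneg (by positivity),
          Real.norm_of_nonneg (by positivity)]
      have hcomm : ((2 : ℝ) ^ i) ^ (1 + γ) = ((2 : ℝ) ^ (1 + γ)) ^ i := by
        rw [← Real.rpow_natCast, ← Real.rpow_natCast, ← Real.rpow_mul (by norm_num),
          ← Real.rpow_mul (by norm_num), mul_comm]
      have hset : {x | (x, (2 : ℝ) ^ (k₀ + (i : ℤ)) • h) ∈ {z | a < diffQuot (1 + γ) u z}} =
          {x | a * ((2 : ℝ) ^ k₀ * ‖h‖) ^ (1 + γ) * ((2 : ℝ) ^ (1 + γ)) ^ i <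
          |u (x + (2 : ℝ) ^ i • (2 : ℝ) ^ k₀ • h) - u x|} := by
        ext x
        change a < |u (x + (2 : ℝ) ^ (k₀ + (i : ℤ)) • h) - u x| /
          ‖(2 : ℝ) ^ (k₀ + (i : ℤ)) • h‖ ^ (1 + γ) ↔ (_ : ℝ) < _
        rw [hnorm, lt_div_iff₀ (by positivity), Real.mul_rpow (by positivity) (by positivity),
          hcomm, hsm, mul_comm (((2 : ℝ) ^ (1 + γ)) ^ i), mul_assoc]
      rw [hset, ← mul_assoc, ← mul_assoc, ← ENNReal.ofReal_mul (by positivity),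
        ← ENNReal.ofReal_mul (by positivity), hnorm, finrank_euclideanSpace_fin,
        zpow_add₀ two_ne_zero, zpow_natCast]
      congr 2
      have e1 : ∀ y : ℝ, 0 < y → y ^ (γ - (n : ℝ)) = y ^ (1 + γ) * y⁻¹ * (y ^ n)⁻¹ := by
        intro y hy
        rw [Real.rpow_sub hy, Real.rpow_add hy, Real.rpow_one, Real.rpow_natCast]
        field_simp
      rw [e1 _ (by positivity), Real.mul_rpow (by positivity) (by positivity), hcomm, div_pow]
      field_simp
      simp only [mul_pow]
    rw [Finset.sum_congr rfl hterm, ← Finset.mul_sum]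
    calc _ ≤ ENNReal.ofReal (a⁻¹ * ((2 : ℝ) ^ k₀)⁻¹ * (‖h‖ ^ n)⁻¹ * ‖h‖⁻¹) *
          (ENNReal.ofReal A * (ENNReal.ofReal ‖(2 : ℝ) ^ k₀ • h‖ * bvNorm u)) :=
          mul_le_mul_right (hmain.trans (mul_le_mul_right
            (lintegral_abs_sub_translate_le_bvNorm hui _) _)) _
      -- The `L^1` translation bound supplies `2 ^ k₀ * ‖h‖`, which cancels the prefactor and makes
      -- the bound independent of the window.
      _ = ENNReal.ofReal (A / a * (‖h‖ ^ n)⁻¹) * bvNorm u := by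
          rw [← mul_assoc, ← mul_assoc, ← ENNReal.ofReal_mul (by positivity),
            ← ENNReal.ofReal_mul (by positivity), norm_smul, Real.norm_of_nonneg h2k.le]
          congr 2
          field_simp
      _ ≤ _ := by
          gcongr
          exact mul_le_of_le_one_right (by positivity) (inv_le_one_of_one_le₀ (one_le_pow₀ hh1))
  calc _ ≤ ∫⁻ _ in An, ENNReal.ofReal (A / a) * bvNorm u := setLIntegral_mono' hAnm hpt
    _ = ENNReal.ofReal (A / a) * bvNorm u * volume An := setLIntegral_const _ _
    _ ≤ ENNReal.ofReal (A / a) * bvNorm u * ENNReal.ofReal ((volume An).toReal + 1) := by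
        gcongr
        conv_lhs => rw [← ENNReal.ofReal_toReal hAnfin.ne]
        exact ENNReal.ofReal_le_ofReal (by linarith)
    _ = _ := by
        rw [mul_right_comm, ← ENNReal.ofReal_mul (by positivity)]
        congr 2
        ring

end WeakType

/-! ### Invariance under changes on null sets. -/

section Congr

variable {n : ℕ} {u v : EuclideanSpace ℝ (Fin n) → ℝ}

/-- The shear `(x, h) ↦ (x, x + h)` preserves the product measure, so null sets pull back to null
sets. -/
theorem diffQuot_ae_eq (h : u =ᵐ[volume] v) (b : ℝ) :
    diffQuot b u =ᵐ[(volume : Measure (EuclideanSpace ℝ (Fin n))).prod volume] diffQuot b v := by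
  have h1 := Measure.quasiMeasurePreserving_fst
    (μ := (volume : Measure (EuclideanSpace ℝ (Fin n))))
    (ν := (volume : Measure (EuclideanSpace ℝ (Fin n)))) |>.ae h
  have h2 := (Measure.quasiMeasurePreserving_snd
    (μ := (volume : Measure (EuclideanSpace ℝ (Fin n))))
    (ν := (volume : Measure (EuclideanSpace ℝ (Fin n))))).comp
    (measurePreserving_prod_add volume volume).quasiMeasurePreserving |>.ae h
  filter_upwards [h1, h2] with z hz1 hz2
  have hz2 : u (z.1 + z.2) = v (z.1 + z.2) := hz2
  simp only [diffQuot, hz1, hz2]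

theorem nuMeasure_absolutelyContinuous (n : ℕ) (γ : ℝ) :
    nuMeasure n γ ≪ (volume : Measure (EuclideanSpace ℝ (Fin n))).prod volume :=
  withDensity_absolutelyContinuous _ _

theorem fracSobolevNorm_congr_ae (h : u =ᵐ[volume] v) (t q : ℝ) :
    fracSobolevNorm t q u = fracSobolevNorm t q v := by
  unfold fracSobolevNorm
  congr 1
  refine lintegral_congr_ae ?_
  filter_upwards [diffQuot_ae_eq h (t + (n : ℝ) / q)] with z hz
  rw [hz]

theorem bvNorm_congr_ae (h : u =ᵐ[volume] v) : bvNorm u = bvNorm v := by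
  unfold bvNorm
  refine iSup_congr fun φ => iSup_congr fun _ => iSup_congr fun _ => iSup_congr fun _ => ?_
  congr 2
  exact integral_congr_ae (h.mul (Filter.EventuallyEq.refl _ (divergence φ)))

theorem lorentzQuasiNorm_congr_ae {X : Type*} [MeasurableSpace X] {ν : Measure X} {f g : X → ℝ}
    (h : f =ᵐ[ν] g) (p r : ℝ) : lorentzQuasiNorm p r ν f = lorentzQuasiNorm p r ν g := by
  unfold lorentzQuasiNorm
  congr 2
  refine lintegral_congr fun y => ?_
  congr 2
  refine measure_congr ?_
  filter_upwards [h] with x hx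
  exact propext (by change y < |f x| ↔ y < |g x|; rw [hx])

end Congr

/-! ### Proof of the upper bound. -/

section Interpolation

variable {n : ℕ} (u : EuclideanSpace ℝ (Fin n) → ℝ)

theorem diffQuot_zero_right (b : ℝ) (x : EuclideanSpace ℝ (Fin n)) :
    diffQuot b u (x, 0) = 0 := by
  simp [diffQuot]

/-- Both the numerator and the power of `‖h‖` are geometric means. At `h = 0` both sides vanish
since `0 ^ θ = 0` for `θ > 0`. -/
theorem diffQuot_convexComb {θ : ℝ} (hθ0 : 0 < θ) (hθ1 : θ < 1) (b c : ℝ)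
    (z : EuclideanSpace ℝ (Fin n) × EuclideanSpace ℝ (Fin n)) :
    diffQuot ((1 - θ) * b + θ * c) u z = diffQuot b u z ^ (1 - θ) * diffQuot c u z ^ θ := by
  obtain ⟨x, h⟩ := z
  rcases eq_or_ne h 0 with rfl | hh
  · rw [diffQuot_zero_right, diffQuot_zero_right, diffQuot_zero_right, Real.zero_rpow hθ0.ne',
      mul_zero]
  · have hh : 0 < ‖h‖ := norm_pos_iff.2 hh
    simp only [diffQuot]
    rw [Real.div_rpow (abs_nonneg _) (by positivity), Real.div_rpow (abs_nonneg _) (by positivity),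
      div_mul_div_comm, ← Real.rpow_add_of_nonneg (abs_nonneg _) (by linarith) hθ0.le,
      ← Real.rpow_mul hh.le, ← Real.rpow_mul hh.le, ← Real.rpow_add hh, sub_add_cancel,
      Real.rpow_one, mul_comm b, mul_comm c]

/-- The shift `γ / q` in the order offsets the density `‖h‖ ^ (γ - n)`, so the integral does not
depend on `γ`. -/
theorem lintegral_diffQuot_rpow_nuMeasure (hu : Measurable u) {q : ℝ} (hq : 0 < q) (t γ : ℝ) :
    ∫⁻ z, ENNReal.ofReal (diffQuot (t + γ / q) u z ^ q) ∂(nuMeasure n γ) =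
      fracSobolevNorm t q u ^ q := by
  rw [fracSobolevNorm, ← ENNReal.rpow_mul, one_div_mul_cancel hq.ne', ENNReal.rpow_one, nuMeasure,
    lintegral_withDensity_eq_lintegral_mul _ (by fun_prop)
    (((measurable_diffQuot hu _).pow_const q).ennreal_ofReal)]
  refine lintegral_congr fun z => ?_
  obtain ⟨x, h⟩ := z
  rw [Pi.mul_apply, ← ENNReal.ofReal_mul (by positivity)]
  congr 1
  rcases eq_or_ne h 0 with rfl | hh
  · rw [diffQuot_zero_right, diffQuot_zero_right, Real.zero_rpow hq.ne', mul_zero]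
  · have hh : 0 < ‖h‖ := norm_pos_iff.2 hh
    simp only [diffQuot]
    rw [Real.div_rpow (abs_nonneg _) (by positivity), Real.div_rpow (abs_nonneg _) (by positivity),
      ← Real.rpow_mul hh.le, ← Real.rpow_mul hh.le, mul_div_left_comm, Real.rpow_sub hh, add_mul,
      add_mul, div_mul_cancel₀ _ hq.ne', div_mul_cancel₀ _ hq.ne', Real.rpow_add hh,
      Real.rpow_add hh]
    have := (Real.rpow_pos_of_pos hh γ).ne'
    field_simp

/-- The Gagliardo–Nirenberg inequality between `BV` and a fractional Sobolev space, in the Lorentz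
scale. -/
theorem exists_lorentzQuasiNorm_diffQuot_le (hn : 1 ≤ n) {t q θ p s γ : ℝ} (hq : 1 < q)
    (hθ0 : 0 < θ) (hθ1 : θ < 1)
    (hp : 1 / p = (1 - θ) * (1 / q) + θ * 1) (hs : s = (1 - θ) * t + θ * 1)
    (hγ : γ ∉ Set.Icc (-1 : ℝ) 0) :
    ∃ C : ℝ≥0, ∀ u : EuclideanSpace ℝ (Fin n) → ℝ, MemBV u → MemFracSobolev t q u →
      lorentzQuasiNorm p (q / (1 - θ)) (nuMeasure n γ) (diffQuot (s + γ / p) u)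
        ≤ C * (fracSobolevNorm t q u ^ (1 - θ) * bvNorm u ^ θ) := by
  obtain ⟨W, hW, hWu⟩ := exists_nuMeasure_diffQuot_le hn hγ
  have hθ' : 0 < 1 - θ := by linarith
  set r := q / (1 - θ) with hr
  have hr0 : 0 < r := by positivity
  have hrp : r / p = 1 + θ * r := by
    rw [div_eq_mul_one_div, hp, hr]
    field_simp
  have hc0 : 0 ≤ 2 * (1 + θ * r) * (2 * W) ^ (θ * r) := by positivity
  refine ⟨((2 * (1 + θ * r) * (2 * W) ^ (θ * r)) ^ (1 / r)).toNNReal, fun u' hbv' hfr' => ?_⟩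
  -- The tree argument needs genuine measurability; every quantity in the inequality is unchanged by
  -- passing to this representative.
  obtain ⟨v, hvm, huv⟩ := hbv'.1.aestronglyMeasurable.aemeasurable
  have hvi : LocallyIntegrable v volume := by
    intro x
    obtain ⟨s, hs, hi⟩ := hbv'.1 x
    exact ⟨s, hs, hi.congr_fun_ae (ae_restrict_of_ae huv)⟩
  have hB : bvNorm v < ⊤ := bvNorm_congr_ae huv ▸ hbv'.2
  have hF : fracSobolevNorm t q v < ⊤ := fracSobolevNorm_congr_ae huv t q ▸ hfr'.2
  rw [lorentzQuasiNorm_congr_ae ((nuMeasure_absolutelyContinuous n γ).ae_eq (diffQuot_ae_eq huv _)),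
    bvNorm_congr_ae huv, fracSobolevNorm_congr_ae huv]
  set B := (bvNorm v).toReal with hBdef
  have hB0 : 0 ≤ B := ENNReal.toReal_nonneg
  have hBv : bvNorm v = ENNReal.ofReal B := (ENNReal.ofReal_toReal hB.ne).symm
  -- The Hölder inequality asks for a positive weak-type constant, while the total variation may be
  -- `0`; hence `B + ε`, followed by `ε → 0`.
  have key : ∀ ε : ℝ, 0 < ε →
      lorentzQuasiNorm p r (nuMeasure n γ) (diffQuot (s + γ / p) v) ≤
      (ENNReal.ofReal ((2 * (1 + θ * r) * (2 * W) ^ (θ * r)) ^ (1 / r)) *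
        fracSobolevNorm t q v ^ (1 - θ)) * ENNReal.ofReal (B + ε) ^ θ := by
    intro ε hε
    have hBε : 0 < B + ε := by linarith
    have hmain := lintegral_rpow_mul_distribution_le (ν := nuMeasure n γ) hr0 hθ0
      (mul_pos hW hBε) (f := fun z => |diffQuot (s + γ / p) v z|)
      (G := fun z => diffQuot (t + γ / q) v z ^ (1 - θ)) (k := diffQuot (1 + γ) v)
      ((measurable_diffQuot hvm _).pow_const _).aemeasurable
      (fun z => Real.rpow_nonneg (diffQuot_nonneg _ _ _) _) (diffQuot_nonneg _ _)
      (fun z => by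
        rw [abs_of_nonneg (diffQuot_nonneg _ _ _), ← diffQuot_convexComb v hθ0 hθ1]
        apply le_of_eq
        congr 1
        rw [hs, div_eq_mul_one_div γ p, hp]
        ring)
      (fun a ha => by
        refine (hWu v hvm hvi a ha).trans ?_
        rw [hBv, ← ENNReal.ofReal_mul (by positivity)]
        refine ENNReal.ofReal_le_ofReal ?_
        rw [div_mul_eq_mul_div]
        gcongr
        linarith)
    have hGr : ∀ z, (diffQuot (t + γ / q) v z ^ (1 - θ)) ^ r = diffQuot (t + γ / q) v z ^ q := by
      intro z
      rw [← Real.rpow_mul (diffQuot_nonneg _ _ _), hr, mul_div_cancel₀ _ hθ'.ne']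
    simp_rw [hGr] at hmain
    rw [lintegral_diffQuot_rpow_nuMeasure v hvm (by linarith)] at hmain
    unfold lorentzQuasiNorm
    rw [hrp]
    refine (ENNReal.rpow_le_rpow hmain (by positivity)).trans_eq ?_
    rw [ENNReal.mul_rpow_of_nonneg _ _ (by positivity), ← ENNReal.rpow_mul, hr, one_div_div,
      mul_div_cancel₀ _ (by linarith : q ≠ 0), ← mul_assoc 2 W, Real.mul_rpow (by positivity) hBε.le,
      ← mul_assoc (2 * (1 + θ * (q / (1 - θ)))), ENNReal.ofReal_mul (by positivity),
      ENNReal.mul_rpow_of_nonneg _ _ (by positivity),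
      ENNReal.ofReal_rpow_of_nonneg (by positivity) (by positivity),
      ENNReal.ofReal_rpow_of_nonneg (by positivity) (by positivity), ← Real.rpow_mul hBε.le,
      ENNReal.ofReal_rpow_of_nonneg hBε.le hθ0.le]
    have : θ * (q / (1 - θ)) * ((1 - θ) / q) = θ := by
      field_simp
    rw [this]
    ring
  have hfin : ENNReal.ofReal ((2 * (1 + θ * r) * (2 * W) ^ (θ * r)) ^ (1 / r)) *
      fracSobolevNorm t q v ^ (1 - θ) ≠ ⊤ :=
    ENNReal.mul_ne_top ENNReal.ofReal_ne_top (ENNReal.rpow_ne_top_of_nonneg hθ'.le hF.ne)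
  have hlim : Filter.Tendsto (fun ε : ℝ => (ENNReal.ofReal
        ((2 * (1 + θ * r) * (2 * W) ^ (θ * r)) ^ (1 / r)) *
        fracSobolevNorm t q v ^ (1 - θ)) * ENNReal.ofReal (B + ε) ^ θ) (nhdsWithin 0 (Set.Ioi 0))
      (nhds ((ENNReal.ofReal ((2 * (1 + θ * r) * (2 * W) ^ (θ * r)) ^ (1 / r)) *
        fracSobolevNorm t q v ^ (1 - θ)) * ENNReal.ofReal (B + 0) ^ θ)) := by
    refine ENNReal.Tendsto.const_mul ?_ (Or.inr hfin)
    have hc : Continuous fun ε : ℝ => ENNReal.ofReal (B + ε) ^ θ :=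
      (ENNReal.continuous_rpow_const).comp (ENNReal.continuous_ofReal.comp (by fun_prop))
    exact (hc.tendsto 0).mono_left nhdsWithin_le_nhds
  refine (ge_of_tendsto hlim ?_).trans_eq ?_
  · filter_upwards [self_mem_nhdsWithin] with ε hε using key ε hε
  · rw [add_zero, ← hBv, mul_assoc]
    rfl

end Interpolation

/-! ### The smoothed Cantor staircase. -/

/-- Smooth approximations of the distribution function of a Cantor measure with contraction ratio
`l` and weights `α` and `1 - α`. -/
noncomputable def smoothCantor (α l : ℝ) : ℕ → ℝ → ℝ
  | 0, x => Real.smoothTransition x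
  | N + 1, x => α * smoothCantor α l N (x / l) + (1 - α) * smoothCantor α l N ((x - (1 - l)) / l)

section CantorStep

variable {α l : ℝ}

theorem contDiff_smoothCantor (α l : ℝ) (N : ℕ) : ContDiff ℝ ∞ (smoothCantor α l N) := by
  induction N with
  | zero => exact Real.smoothTransition.contDiff
  | succ N ih =>
    have h1 : ContDiff ℝ ∞ fun x : ℝ => smoothCantor α l N (x / l) :=
      ih.comp (contDiff_id.div_const l)
    have h2 : ContDiff ℝ ∞ fun x : ℝ => smoothCantor α l N ((x - (1 - l)) / l) :=
      ih.comp ((contDiff_id.sub contDiff_const).div_const l)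
    exact (contDiff_const.mul h1).add (contDiff_const.mul h2)

theorem smoothCantor_of_nonpos (hl0 : 0 < l) (hl : l < 1 / 2) (N : ℕ) {x : ℝ} (hx : x ≤ 0) :
    smoothCantor α l N x = 0 := by
  induction N generalizing x with
  | zero => exact Real.smoothTransition.zero_of_nonpos hx
  | succ N ih =>
    rw [smoothCantor, ih (div_nonpos_of_nonpos_of_nonneg hx hl0.le),
      ih (div_nonpos_of_nonpos_of_nonneg (by linarith) hl0.le)]
    ring

theorem smoothCantor_of_one_le (hl0 : 0 < l) (hl : l < 1 / 2) (N : ℕ) {x : ℝ} (hx : 1 ≤ x) :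
    smoothCantor α l N x = 1 := by
  induction N generalizing x with
  | zero => exact Real.smoothTransition.one_of_one_le hx
  | succ N ih =>
    rw [smoothCantor, ih (by rw [le_div_iff₀ hl0]; linarith), ih (by rw [le_div_iff₀ hl0]; linarith)]
    ring

theorem monotone_smoothCantor (hα0 : 0 ≤ α) (hα1 : α ≤ 1) (hl0 : 0 < l) (N : ℕ) :
    Monotone (smoothCantor α l N) := by
  induction N with
  | zero => exact Real.smoothTransition.monotone
  | succ N ih =>
    intro x y hxy
    have h1 : x / l ≤ y / l := by gcongr
    have h2 : (x - (1 - l)) / l ≤ (y - (1 - l)) / l := by gcongr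
    exact add_le_add (mul_le_mul_of_nonneg_left (ih h1) hα0)
      (mul_le_mul_of_nonneg_left (ih h2) (by linarith))

theorem smoothCantor_nonneg (hα0 : 0 ≤ α) (hα1 : α ≤ 1) (hl0 : 0 < l) (hl : l < 1 / 2) (N : ℕ)
    (x : ℝ) : 0 ≤ smoothCantor α l N x := by
  rw [← smoothCantor_of_nonpos (α := α) hl0 hl N (min_le_right x 0)]
  exact monotone_smoothCantor hα0 hα1 hl0 N (min_le_left x 0)

theorem smoothCantor_le_one (hα0 : 0 ≤ α) (hα1 : α ≤ 1) (hl0 : 0 < l) (hl : l < 1 / 2) (N : ℕ)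
    (x : ℝ) : smoothCantor α l N x ≤ 1 := by
  rw [← smoothCantor_of_one_le (α := α) hl0 hl N (le_max_right x 1)]
  exact monotone_smoothCantor hα0 hα1 hl0 N (le_max_left x 1)

/-- Up to `1 - l` the right-hand copy has not started, so only the left one moves. The next lemma is
the mirror image, past the end of the left copy. -/
theorem smoothCantor_succ_sub_of_le (hl0 : 0 < l) (hl : l < 1 / 2) (N : ℕ) {x y : ℝ}
    (hx : x ≤ 1 - l) (hy : y ≤ 1 - l) :
    smoothCantor α l (N + 1) y - smoothCantor α l (N + 1) x =
      α * (smoothCantor α l N (y / l) - smoothCantor α l N (x / l)) := by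
  rw [smoothCantor, smoothCantor, smoothCantor_of_nonpos hl0 hl N (x := (y - (1 - l)) / l)
    (div_nonpos_of_nonpos_of_nonneg (by linarith) hl0.le),
    smoothCantor_of_nonpos hl0 hl N (x := (x - (1 - l)) / l)
    (div_nonpos_of_nonpos_of_nonneg (by linarith) hl0.le)]
  ring

theorem smoothCantor_succ_sub_of_ge (hl0 : 0 < l) (hl : l < 1 / 2) (N : ℕ) {x y : ℝ}
    (hx : l ≤ x) (hy : l ≤ y) :
    smoothCantor α l (N + 1) y - smoothCantor α l (N + 1) x =
      (1 - α) * (smoothCantor α l N ((y - (1 - l)) / l) - smoothCantor α l N ((x - (1 - l)) / l)) := by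
  rw [smoothCantor, smoothCantor, smoothCantor_of_one_le hl0 hl N (x := y / l)
    (by rw [le_div_iff₀ hl0]; linarith), smoothCantor_of_one_le hl0 hl N (x := x / l)
    (by rw [le_div_iff₀ hl0]; linarith)]
  ring

theorem Real.exists_smoothTransition_sub_le : ∃ L : ℝ, 1 ≤ L ∧ ∀ x y : ℝ, x ≤ y →
    Real.smoothTransition y - Real.smoothTransition x ≤ L * (y - x) := by
  have hC : ContDiffOn ℝ 1 Real.smoothTransition (Set.Icc (0 : ℝ) 1) :=
    (Real.smoothTransition.contDiff (n := 1)).contDiffOn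
  obtain ⟨K, hK⟩ := hC.exists_lipschitzOnWith one_ne_zero (convex_Icc 0 1) isCompact_Icc
  refine ⟨K + 1, by simp, fun x y hxy => ?_⟩
  rw [← Real.smoothTransition.projIcc (x := x), ← Real.smoothTransition.projIcc (x := y)]
  have h1 := hK.dist_le_mul _ (Set.projIcc (0 : ℝ) 1 zero_le_one y).2 _
    (Set.projIcc (0 : ℝ) 1 zero_le_one x).2
  have h2 : |(Set.projIcc (0 : ℝ) 1 zero_le_one y : ℝ) - Set.projIcc (0 : ℝ) 1 zero_le_one x| ≤
    |y - x| := Set.abs_projIcc_sub_projIcc zero_le_one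
  rw [Real.dist_eq, Real.dist_eq] at h1
  rw [abs_of_nonneg (by linarith : 0 ≤ y - x)] at h2
  calc _ ≤ _ := le_abs_self _
    _ ≤ _ := h1
    _ ≤ K * (y - x) := mul_le_mul_of_nonneg_left h2 K.2
    _ ≤ _ := by nlinarith

/-- Self-similarity: an interval meeting only one copy is rescaled by `1 / l`, and `α * (z / l) ^ d
= z ^ d` reproduces the Hölder bound with the same `H`. The right copy has weight `1 - α ≤ α`, so it
is no worse. -/
theorem exists_smoothCantor_sub_le {d : ℝ} (hd0 : 0 ≤ d) (hd1 : d ≤ 1) (hl0 : 0 < l) (hl : l < 1 / 2)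
    (hα0 : 1 / 2 ≤ α) (hα1 : α ≤ 1) (hα : α = l ^ d) :
    ∃ H : ℝ, 1 ≤ H ∧ ∀ (N : ℕ) (x y : ℝ), x ≤ y →
      smoothCantor α l N y - smoothCantor α l N x ≤ H * (y - x) ^ d ∧
      smoothCantor α l N y - smoothCantor α l N x ≤ H * (α / l) ^ N * (y - x) := by
  obtain ⟨L, hL1, hL⟩ := Real.exists_smoothTransition_sub_le
  have hg : 0 < 1 - 2 * l := by linarith
  have hgd : 0 < (1 - 2 * l) ^ (-d) := by positivity
  -- `L` serves the initial function; the other summand serves intervals that cross the whole gap,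
  -- of length `1 - 2 * l`.
  refine ⟨L + (1 - 2 * l) ^ (-d), by linarith, fun N => ?_⟩
  set H := L + (1 - 2 * l) ^ (-d) with hH
  have hH1 : 1 ≤ H := by linarith
  have hbd : ∀ N x y, smoothCantor α l N y - smoothCantor α l N x ≤ 1 := fun N x y => by
    have h1 := smoothCantor_nonneg (α := α) (by linarith) hα1 hl0 hl N x
    have h2 := smoothCantor_le_one (α := α) (by linarith) hα1 hl0 hl N y
    linarith
  induction N with
  | zero =>
    intro x y hxy
    have h1 := hL x y hxy
    have h0 : 0 ≤ y - x := by linarith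
    have hpos : 0 ≤ (y - x) ^ d := Real.rpow_nonneg h0 d
    constructor
    · rcases le_total (y - x) 1 with h | h
      · calc _ ≤ L * (y - x) := h1
          _ ≤ L * (y - x) ^ d := by
            gcongr
            exact Real.self_le_rpow_of_le_one h0 h hd1
          _ ≤ _ := by
            gcongr
            linarith
      · have h2 := hbd 0 x y
        have h3 := Real.one_le_rpow h hd0
        nlinarith
    · rw [pow_zero, mul_one]
      exact h1.trans (by gcongr; linarith)
  | succ N ih =>
    have hαl : 0 < α / l := by
      have : 0 < α := by linarith
      positivity
    have hscale : ∀ z : ℝ, 0 ≤ z → α * (H * (z / l) ^ d) = H * z ^ d := by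
      intro z hz
      rw [Real.div_rpow hz hl0.le, ← hα]
      have : α ≠ 0 := by linarith
      field_simp
    have hscale2 : ∀ z : ℝ, α * (H * (α / l) ^ N * (z / l)) = H * (α / l) ^ (N + 1) * z := by
      intro z
      rw [pow_succ]
      field_simp
    have hleft : ∀ x y : ℝ, x ≤ y → y ≤ 1 - l →
        smoothCantor α l (N + 1) y - smoothCantor α l (N + 1) x ≤ H * (y - x) ^ d ∧
        smoothCantor α l (N + 1) y - smoothCantor α l (N + 1) x ≤ H * (α / l) ^ (N + 1) * (y - x) := by
      intro x y hxy hy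
      obtain ⟨h1, h2⟩ := ih (x / l) (y / l) (by gcongr)
      rw [smoothCantor_succ_sub_of_le hl0 hl N (by linarith) hy, ← hscale _ (by linarith),
        ← hscale2]
      rw [← sub_div] at h1 h2
      exact ⟨mul_le_mul_of_nonneg_left h1 (by linarith),
        mul_le_mul_of_nonneg_left h2 (by linarith)⟩
    have hright : ∀ x y : ℝ, x ≤ y → l ≤ x →
        smoothCantor α l (N + 1) y - smoothCantor α l (N + 1) x ≤ H * (y - x) ^ d ∧
        smoothCantor α l (N + 1) y - smoothCantor α l (N + 1) x ≤ H * (α / l) ^ (N + 1) * (y - x) := by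
      intro x y hxy hx
      obtain ⟨h1, h2⟩ := ih ((x - (1 - l)) / l) ((y - (1 - l)) / l) (by gcongr)
      have hmono := monotone_smoothCantor (α := α) (by linarith) hα1 hl0 N
        (by gcongr : (x - (1 - l)) / l ≤ (y - (1 - l)) / l)
      rw [smoothCantor_succ_sub_of_ge hl0 hl N hx (by linarith), ← hscale _ (by linarith),
        ← hscale2]
      rw [← sub_div, sub_sub_sub_cancel_right] at h1 h2
      exact ⟨mul_le_mul (by linarith) h1 (by linarith) (by linarith),
        mul_le_mul (by linarith) h2 (by linarith) (by linarith)⟩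
    intro x y hxy
    by_cases hy : y ≤ 1 - l
    · exact hleft x y hxy hy
    by_cases hx : l ≤ x
    · exact hright x y hxy hx
    push Not at hx hy
    constructor
    -- The interval contains the gap, so the trivial bound `1` for the increment is enough.
    · have h1 : 1 ≤ (1 - 2 * l) ^ (-d) * (y - x) ^ d := by
        rw [Real.rpow_neg hg.le, ← Real.inv_rpow hg.le, ← Real.mul_rpow (by positivity)
          (by linarith)]
        refine Real.one_le_rpow ?_ hd0
        rw [inv_mul_eq_div, le_div_iff₀ hg]
        linarith
      have h2 := hbd (N + 1) x y
      have h3 : 0 ≤ (y - x) ^ d := Real.rpow_nonneg (by linarith) d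
      have h4 : (1 - 2 * l) ^ (-d) * (y - x) ^ d ≤ H * (y - x) ^ d := by
        gcongr
        linarith
      linarith
    -- The Lipschitz bound is additive, so the interval is cut at `1 / 2`, inside the gap.
    · have h1 := (hleft x (1 / 2) (by linarith) (by linarith)).2
      have h2 := (hright (1 / 2) y (by linarith) (by linarith)).2
      have h3 : H * (α / l) ^ (N + 1) * (y - x) = H * (α / l) ^ (N + 1) * (1 / 2 - x) +
        H * (α / l) ^ (N + 1) * (y - 1 / 2) := by ring
      linarith

theorem Real.volume_preimage_sub_div {l : ℝ} (hl0 : 0 < l) (c : ℝ) (s : Set ℝ) :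
    volume {x : ℝ | (x - c) / l ∈ s} = ENNReal.ofReal l * volume s := by
  have h1 : {x : ℝ | (x - c) / l ∈ s} = (fun x => x - c) ⁻¹' ((fun x => x * l⁻¹) ⁻¹' s) := by
    ext x
    simp [div_eq_mul_inv]
  rw [h1]
  simp_rw [sub_eq_add_neg]
  rw [measure_preimage_add_right, Real.volume_preimage_mul_right (inv_ne_zero hl0.ne'), inv_inv,
    abs_of_pos hl0]

/-- At scale `l ^ k`, the increments of `smoothCantor` of size at least `α ^ k` occupy a set of measure
comparable to `(l / α) ^ k`. -/
theorem le_volume_smoothCantor_increment (hl0 : 0 < l) (hl : l < 1 / 2) (hα : α = 1 / 2 ∨ α = 1)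
    {δ : ℝ} (hδ : δ = (1 - 2 * l) / 4) (k M : ℕ) {h : ℝ}
    (h1 : l ^ k * (1 + δ) ≤ h) (h2 : h ≤ l ^ k * (1 + 2 * δ)) :
    ENNReal.ofReal (δ * (l / α) ^ k) ≤ volume {x : ℝ | x ∈ Set.Icc (-2 * δ) 1 ∧
      α ^ k ≤ smoothCantor α l (k + M) (x + h) - smoothCantor α l (k + M) x} := by
  have hδ0 : 0 < δ := by linarith
  have hα0 : 1 / 2 ≤ α := by rcases hα with h | h <;> linarith
  have hα1 : α ≤ 1 := by rcases hα with h | h <;> linarith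
  have hmono := monotone_smoothCantor (α := α) (by linarith) hα1 hl0
  induction k generalizing h with
  | zero =>
    rw [pow_zero, one_mul] at h1 h2
    -- For these `x` the step goes from `x ≤ 0` to `x + h ≥ 1` and sees the full rise; the interval
    -- has length `h - 1 ≥ δ`.
    calc _ ≤ volume (Set.Icc (1 - h) 0) := by
          rw [Real.volume_Icc]
          apply ENNReal.ofReal_le_ofReal
          rw [pow_zero]
          linarith
      _ ≤ _ := by
          refine measure_mono fun x hx => ⟨⟨by linarith [hx.1], by linarith [hx.2]⟩, ?_⟩
          rw [smoothCantor_of_nonpos hl0 hl _ hx.2,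
            smoothCantor_of_one_le hl0 hl _ (by linarith [hx.1]), pow_zero, sub_zero]
  | succ k ih =>
    have h1' : l ^ k * (1 + δ) ≤ h / l := by
      rw [le_div_iff₀ hl0]
      rw [pow_succ] at h1
      linarith
    have h2' : h / l ≤ l ^ k * (1 + 2 * δ) := by
      rw [div_le_iff₀ hl0]
      rw [pow_succ] at h2
      linarith
    have hh : 0 ≤ h := le_trans (by positivity) h1
    have hih := ih h1' h2'
    set A : Set ℝ := {x : ℝ | x ∈ Set.Icc (-2 * δ) 1 ∧
      α ^ k ≤ smoothCantor α l (k + M) (x + h / l) - smoothCantor α l (k + M) x} with hA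
    have hAm : MeasurableSet A := by
      have hc := (contDiff_smoothCantor α l (k + M)).continuous
      exact measurableSet_Icc.inter (measurableSet_le measurable_const
        (by fun_prop : Continuous fun x : ℝ => smoothCantor α l (k + M) (x + h / l) -
          smoothCantor α l (k + M) x).measurable)
    have hstep : ∀ x : ℝ, smoothCantor α l (k + 1 + M) (x + h) - smoothCantor α l (k + 1 + M) x =
        α * (smoothCantor α l (k + M) (x / l + h / l) - smoothCantor α l (k + M) (x / l)) +
        (1 - α) * (smoothCantor α l (k + M) ((x - (1 - l)) / l + h / l) -
          smoothCantor α l (k + M) ((x - (1 - l)) / l)) := by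
      intro x
      rw [show k + 1 + M = (k + M) + 1 by ring, smoothCantor, smoothCantor, add_div,
        show (x + h - (1 - l)) / l = (x - (1 - l)) / l + h / l by ring]
      ring
    have hinc : ∀ y : ℝ, 0 ≤ smoothCantor α l (k + M) (y + h / l) - smoothCantor α l (k + M) y :=
      fun y => sub_nonneg.2 (hmono _ (le_add_of_nonneg_right (by positivity)))
    have hsub1 : {x : ℝ | (x - 0) / l ∈ A} ⊆ {x : ℝ | x ∈ Set.Icc (-2 * δ) 1 ∧
        α ^ (k + 1) ≤ smoothCantor α l (k + 1 + M) (x + h) - smoothCantor α l (k + 1 + M) x} := by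
      intro x hx
      have hx : (x - 0) / l ∈ A := hx
      rw [sub_zero] at hx
      obtain ⟨⟨hx1, hx2⟩, hx3⟩ := hx
      rw [le_div_iff₀ hl0] at hx1
      rw [div_le_iff₀ hl0] at hx2
      refine ⟨⟨by nlinarith, by linarith⟩, ?_⟩
      rw [hstep, pow_succ]
      have := mul_nonneg (by linarith : 0 ≤ 1 - α) (hinc ((x - (1 - l)) / l))
      have := mul_le_mul_of_nonneg_left hx3 (by linarith : 0 ≤ α)
      linarith
    -- For `α = 1 / 2` both copies contribute, giving measure factor `2 * l = l / α`; for `α = 1`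
    -- the right copy has weight zero and the left alone gives `l = l / α`.
    rcases hα with hα | hα
    · have hsub2 : {x : ℝ | (x - (1 - l)) / l ∈ A} ⊆ {x : ℝ | x ∈ Set.Icc (-2 * δ) 1 ∧
          α ^ (k + 1) ≤ smoothCantor α l (k + 1 + M) (x + h) - smoothCantor α l (k + 1 + M) x} := by
        intro x hx
        obtain ⟨⟨hx1, hx2⟩, hx3⟩ := hx
        rw [le_div_iff₀ hl0] at hx1
        rw [div_le_iff₀ hl0] at hx2
        refine ⟨⟨by nlinarith, by linarith⟩, ?_⟩
        rw [hstep, pow_succ]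
        have := mul_nonneg (by linarith : 0 ≤ α) (hinc (x / l))
        have := mul_le_mul_of_nonneg_left hx3 (by linarith : 0 ≤ 1 - α)
        have h3 : α ^ k * α = (1 - α) * α ^ k := by
          rw [show 1 - α = α by linarith]
          ring
        linarith
      -- The first set ends at `l` and the second starts at `1 - l - 2 * δ * l`; the gap `1 - 2 * l
      -- = 4 * δ` absorbs the overhang.
      have hdisj : Disjoint {x : ℝ | (x - 0) / l ∈ A} {x : ℝ | (x - (1 - l)) / l ∈ A} := by
        refine Set.disjoint_left.2 fun x hx hy => ?_
        have hx1 := hx.1.2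
        have hy1 := hy.1.1
        rw [le_div_iff₀ hl0] at hy1
        rw [div_le_iff₀ hl0] at hx1
        nlinarith
      have hm2 : MeasurableSet {x : ℝ | (x - (1 - l)) / l ∈ A} :=
        (by fun_prop : Measurable fun x : ℝ => (x - (1 - l)) / l) hAm
      calc ENNReal.ofReal (δ * (l / α) ^ (k + 1))
          = ENNReal.ofReal l * ENNReal.ofReal (δ * (l / α) ^ k) +
            ENNReal.ofReal l * ENNReal.ofReal (δ * (l / α) ^ k) := by
            have : 0 < l / α := div_pos hl0 (by linarith)
            rw [← ENNReal.ofReal_mul hl0.le, ← ENNReal.ofReal_add (by positivity) (by positivity),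
              pow_succ, hα]
            congr 1
            ring
        _ ≤ ENNReal.ofReal l * volume A + ENNReal.ofReal l * volume A := by gcongr
        _ = volume ({x : ℝ | (x - 0) / l ∈ A} ∪ {x : ℝ | (x - (1 - l)) / l ∈ A}) := by
            rw [measure_union hdisj hm2, Real.volume_preimage_sub_div hl0,
              Real.volume_preimage_sub_div hl0]
        _ ≤ _ := measure_mono (Set.union_subset hsub1 hsub2)
    · calc ENNReal.ofReal (δ * (l / α) ^ (k + 1))
          = ENNReal.ofReal l * ENNReal.ofReal (δ * (l / α) ^ k) := by
            rw [← ENNReal.ofReal_mul hl0.le, pow_succ, hα]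
            congr 1
            ring
        _ ≤ ENNReal.ofReal l * volume A := by gcongr
        _ = volume {x : ℝ | (x - 0) / l ∈ A} := (Real.volume_preimage_sub_div hl0 _ _).symm
        _ ≤ _ := measure_mono hsub1

end CantorStep

/-! ### Choice of the Cantor set and geometric sums over scales. -/

/-- For `d > 0` this is the symmetric Cantor set of dimension `d`. For `d = 0` the staircase
degenerates to a single smoothed jump: all the weight goes left, and any `l < 1 / 2` would do. -/
theorem exists_cantor_parameters {d : ℝ} (hd0 : 0 ≤ d) (hd1 : d < 1) :
    ∃ α l : ℝ, 0 < l ∧ l < 1 / 2 ∧ (α = 1 / 2 ∨ α = 1) ∧ α = l ^ d := by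
  rcases hd0.eq_or_lt with rfl | hd
  · exact ⟨1, 1 / 4, by norm_num, by norm_num, Or.inr rfl, by simp⟩
  · refine ⟨1 / 2, (1 / 2) ^ (1 / d), by positivity, ?_, Or.inl rfl, ?_⟩
    · conv_rhs => rw [← Real.rpow_one (1 / 2)]
      exact Real.rpow_lt_rpow_of_exponent_gt (by norm_num) (by norm_num)
        ((one_lt_div hd).2 hd1)
    · rw [← Real.rpow_mul (by norm_num), one_div_mul_cancel hd.ne', Real.rpow_one]

theorem summable_int_pow_natAbs {r : ℝ} (hr0 : 0 ≤ r) (hr1 : r < 1) :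
    Summable fun k : ℤ => r ^ k.natAbs := by
  have h := summable_geometric_of_lt_one hr0 hr1
  exact Summable.of_nat_of_neg (by simpa using h) (by simpa using h)

theorem tsum_int_ofReal_pow_natAbs {r : ℝ} (hr0 : 0 ≤ r) (hr1 : r < 1) (m : ℤ) :
    ∑' k : ℤ, ENNReal.ofReal (r ^ (k + m).natAbs) = ENNReal.ofReal (∑' k : ℤ, r ^ k.natAbs) := by
  rw [ENNReal.ofReal_tsum_of_nonneg (fun k => by positivity) (summable_int_pow_natAbs hr0 hr1)]
  exact (Equiv.addRight m).tsum_eq fun k : ℤ => ENNReal.ofReal (r ^ k.natAbs)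

/-! ### Growth of the Gagliardo seminorm with the number of scales. -/

section SobolevBound

variable {n : ℕ} {u : EuclideanSpace ℝ (Fin n) → ℝ}

/-- One of the `q` factors is integrated and the remaining `q - 1` are bounded by the supremum. -/
theorem lintegral_diffQuot_rpow_section_le {t q : ℝ} (hq : 1 < q)
    {h : EuclideanSpace ℝ (Fin n)} (hh : h ≠ 0) {M B : ℝ} (hM0 : 0 ≤ M)
    (hM : ∀ x, |u (x + h) - u x| ≤ M)
    (hB : ∫⁻ x, ENNReal.ofReal |u (x + h) - u x| ≤ ENNReal.ofReal B) :
    ∫⁻ x, ENNReal.ofReal (diffQuot (t + (n : ℝ) / q) u (x, h) ^ q) ≤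
      ENNReal.ofReal (‖h‖ ^ (-(t * q + n)) * M ^ (q - 1) * B) := by
  have hh : 0 < ‖h‖ := norm_pos_iff.2 hh
  have hc : 0 ≤ ‖h‖ ^ (-(t * q + n)) * M ^ (q - 1) := by positivity
  calc _ ≤ ∫⁻ x, ENNReal.ofReal (‖h‖ ^ (-(t * q + n)) * M ^ (q - 1)) *
        ENNReal.ofReal |u (x + h) - u x| := by
        refine lintegral_mono fun x => ?_
        simp only
        rw [← ENNReal.ofReal_mul hc]
        apply ENNReal.ofReal_le_ofReal
        simp only [diffQuot]
        set D := |u (x + h) - u x| with hD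
        have hD0 : 0 ≤ D := abs_nonneg _
        have h1 : D ^ q = D ^ (q - 1) * D := by
          conv_rhs => rw [← Real.rpow_one D, ← Real.rpow_mul hD0, one_mul]
          rw [← Real.rpow_add_of_nonneg hD0 (by linarith) zero_le_one, sub_add_cancel]
        have h2 : (‖h‖ ^ (t + (n : ℝ) / q)) ^ q = ‖h‖ ^ (t * q + n) := by
          rw [← Real.rpow_mul hh.le, add_mul, div_mul_cancel₀ _ (by linarith : q ≠ 0)]
        rw [Real.div_rpow hD0 (by positivity), h1, h2, Real.rpow_neg hh.le]
        have h3 : D ^ (q - 1) ≤ M ^ (q - 1) := Real.rpow_le_rpow hD0 (hM x) (by linarith)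
        rw [div_eq_inv_mul, ← mul_assoc]
        gcongr
    _ ≤ _ := by
        rw [lintegral_const_mul' _ _ ENNReal.ofReal_ne_top, ENNReal.ofReal_mul hc]
        gcongr

/-- The Gagliardo seminorm, up to the resolution `l ^ N`, of a Hölder function of critical exponent
which is Lipschitz in `L^1`. -/
theorem exists_lintegral_diffQuot_rpow_le (hn : 1 ≤ n) {t q d l H V : ℝ} (ht0 : 0 < t) (ht1 : t < 1)
    (hq : 1 < q) (hd : d * (q - 1) = t * q - 1) (hl0 : 0 < l) (hl1 : l < 1) (hH : 0 < H)
    (hV : 0 < V) :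
    ∃ C : ℝ, 0 < C ∧ ∀ (u : EuclideanSpace ℝ (Fin n) → ℝ) (N : ℕ), Measurable u →
      (∀ x h, |u (x + h) - u x| ≤ H) →
      (∀ x h, |u (x + h) - u x| ≤ H * ‖h‖ ^ d) →
      (∀ x h, |u (x + h) - u x| ≤ H * (l ^ (d - 1)) ^ N * ‖h‖) →
      (∀ h, ∫⁻ x, ENNReal.ofReal |u (x + h) - u x| ≤ ENNReal.ofReal V) →
      (∀ h, ∫⁻ x, ENNReal.ofReal |u (x + h) - u x| ≤ ENNReal.ofReal (V * ‖h‖)) →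
      fracSobolevNorm t q u ^ q ≤ ENNReal.ofReal (C * (N + 1)) := by
  have : NeZero n := ⟨by omega⟩
  have : Nontrivial (EuclideanSpace ℝ (Fin n)) := inferInstance
  set b : ℝ := l⁻¹ with hb
  have hb1 : 1 < b := (one_lt_inv₀ hl0).2 hl1
  have hb0 : 0 < b := by linarith
  set r₁ : ℝ := b ^ (-(t * q)) with hr₁
  set r₂ : ℝ := b ^ (-(q - t * q)) with hr₂
  have htq : 0 < t * q := by positivity
  have htq' : 0 < q - t * q := by nlinarith
  have hr₁0 : 0 < r₁ := by positivity
  have hr₂0 : 0 < r₂ := by positivity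
  have hr₁1 : r₁ < 1 := Real.rpow_lt_one_of_one_lt_of_neg hb1 (by linarith)
  have hr₂1 : r₂ < 1 := Real.rpow_lt_one_of_one_lt_of_neg hb1 (by linarith)
  set c₁ : ℝ := ∑' k : ℤ, r₁ ^ k.natAbs with hc₁
  set c₂ : ℝ := ∑' k : ℤ, r₂ ^ k.natAbs with hc₂
  have hc₁0 : 0 ≤ c₁ := tsum_nonneg fun k => by positivity
  have hc₂0 : 0 ≤ c₂ := tsum_nonneg fun k => by positivity
  set An : Set (EuclideanSpace ℝ (Fin n)) := {x | ‖x‖ ∈ Set.Ico 1 b} with hAn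
  have hAnm : MeasurableSet An := measurable_norm measurableSet_Ico
  have hAnfin : volume An < ⊤ :=
    (measure_mono fun x hx => by
      rw [mem_ball_zero_iff]
      exact hx.2).trans_lt (measure_ball_lt_top (x := (0 : EuclideanSpace ℝ (Fin n))) (r := b))
  set K := H ^ (q - 1) * V with hK
  have hK0 : 0 < K := by positivity
  refine ⟨K * (c₁ + c₂ + 1) * ((volume An).toReal + 1), by positivity,
    fun u N hu hH0 hH1 hH2 hV0 hV1 => ?_⟩
  rw [fracSobolevNorm, ← ENNReal.rpow_mul, one_div_mul_cancel (by linarith), ENNReal.rpow_one]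
  have hmeas : Measurable fun z => ENNReal.ofReal (diffQuot (t + (n : ℝ) / q) u z ^ q) :=
    ((measurable_diffQuot hu _).pow_const q).ennreal_ofReal
  rw [lintegral_prod_symm _ hmeas.aemeasurable,
    lintegral_eq_lintegral_annulus_tsum volume hmeas.lintegral_prod_left' hb1]
  -- Each scale is controlled by just one of the three terms; adding all three avoids splitting the
  -- sum. They decay geometrically away from scale `1`, decay geometrically away from scale `l ^ N`,
  -- and count the `N` scales in between.
  have hterm : ∀ h ∈ An, ∀ k : ℤ,
      ENNReal.ofReal ((b ^ k) ^ Module.finrank ℝ (EuclideanSpace ℝ (Fin n))) *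
        ∫⁻ x, ENNReal.ofReal (diffQuot (t + (n : ℝ) / q) u (x, b ^ k • h) ^ q) ≤
      ENNReal.ofReal K * (ENNReal.ofReal (r₁ ^ (k + 0).natAbs) +
        ENNReal.ofReal (r₂ ^ (k + (N + 1)).natAbs) +
        ((Finset.Ico (-(N : ℤ)) 0 : Finset ℤ) : Set ℤ).indicator 1 k) := by
    intro h hh k
    have hbk : 0 < b ^ k := by positivity
    have hh1 : 1 ≤ ‖h‖ := hh.1
    have hhb : ‖h‖ < b := hh.2
    have hne : b ^ k • h ≠ 0 := by
      rw [smul_ne_zero_iff]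
      exact ⟨hbk.ne', norm_pos_iff.1 (by linarith)⟩
    set ρ := ‖b ^ k • h‖ with hρ
    have hρ' : ρ = b ^ k * ‖h‖ := by rw [hρ, norm_smul, Real.norm_of_nonneg hbk.le]
    have hρ0 : 0 < ρ := norm_pos_iff.2 hne
    have hρk : b ^ k ≤ ρ := by
      rw [hρ']
      exact le_mul_of_one_le_right hbk.le hh1
    have hρk1 : ρ ≤ b ^ (k + 1) := by
      rw [hρ', zpow_add₀ hb0.ne', zpow_one]
      gcongr
    have hsplit : ρ ^ (-(t * q + n)) = ρ ^ (-(t * q)) * (ρ ^ n)⁻¹ := by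
      rw [neg_add, Real.rpow_add hρ0, Real.rpow_neg hρ0.le (n : ℝ), Real.rpow_natCast]
    have hpown : (b ^ k) ^ n * (ρ ^ n)⁻¹ ≤ 1 := by
      rw [← div_eq_mul_inv, div_le_one (by positivity)]
      exact pow_le_pow_left₀ hbk.le hρk n
    have hred : ∀ M B g : ℝ, 0 ≤ M → 0 ≤ B → (∀ x, |u (x + b ^ k • h) - u x| ≤ M) →
        ∫⁻ x, ENNReal.ofReal |u (x + b ^ k • h) - u x| ≤ ENNReal.ofReal B →
        ρ ^ (-(t * q)) * M ^ (q - 1) * B ≤ K * g →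
        ENNReal.ofReal ((b ^ k) ^ Module.finrank ℝ (EuclideanSpace ℝ (Fin n))) *
        ∫⁻ x, ENNReal.ofReal (diffQuot (t + (n : ℝ) / q) u (x, b ^ k • h) ^ q) ≤
        ENNReal.ofReal K * ENNReal.ofReal g := by
      intro M B g hM0 hB0 hM hB hle
      refine (mul_le_mul_right (lintegral_diffQuot_rpow_section_le hq hne hM0 hM hB) _).trans ?_
      rw [← ENNReal.ofReal_mul (by positivity), ← ENNReal.ofReal_mul hK0.le]
      apply ENNReal.ofReal_le_ofReal
      rw [finrank_euclideanSpace_fin, ← hρ, hsplit]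
      have hnn : 0 ≤ ρ ^ (-(t * q)) * M ^ (q - 1) * B := by positivity
      calc _ = (b ^ k) ^ n * (ρ ^ n)⁻¹ * (ρ ^ (-(t * q)) * M ^ (q - 1) * B) := by ring
        _ ≤ 1 * (ρ ^ (-(t * q)) * M ^ (q - 1) * B) := by gcongr
        _ ≤ _ := by rwa [one_mul]
    rcases le_or_gt 0 k with hk | hk
    · -- large scales
      refine (hred H V (r₁ ^ (k + 0).natAbs) hH.le hV.le (fun x => hH0 _ _) (hV0 _) ?_).trans ?_
      · rw [hK, mul_assoc, mul_comm]
        gcongr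
        calc ρ ^ (-(t * q)) ≤ (b ^ k) ^ (-(t * q)) :=
              Real.rpow_le_rpow_of_nonpos hbk hρk (by linarith)
          _ = _ := by
              lift k to ℕ using hk
              rw [add_zero, Int.natAbs_natCast, hr₁, zpow_natCast, ← Real.rpow_natCast,
                ← Real.rpow_natCast, ← Real.rpow_mul hb0.le, ← Real.rpow_mul hb0.le, mul_comm]
      · gcongr
        rw [add_assoc]
        exact le_self_add
    · rcases le_or_gt (-(N : ℤ)) k with hkN | hkN
      · -- intermediate scales
        refine (hred (H * ρ ^ d) (V * ρ) 1 (by positivity) (by positivity) (fun x => hH1 _ _)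
          (hV1 _) ?_).trans ?_
        -- By `d * (q - 1) = t * q - 1` all powers of `ρ` cancel: `d` is the exponent at which every
        -- scale contributes equally.
        · rw [Real.mul_rpow hH.le (by positivity), ← Real.rpow_mul hρ0.le, hd,
            Real.rpow_neg hρ0.le, Real.rpow_sub hρ0, Real.rpow_one, hK]
          have := (Real.rpow_pos_of_pos hρ0 (t * q)).ne'
          apply le_of_eq
          field_simp
        · gcongr
          rw [Set.indicator_of_mem (by simp [hkN, hk])]
          simp
      · -- small scales
        refine (hred (H * (l ^ (d - 1)) ^ N * ρ) (V * ρ) (r₂ ^ (k + (N + 1)).natAbs)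
          (by positivity) (by positivity) (fun x => hH2 _ _) (hV1 _) ?_).trans ?_
        · have e1 : (l ^ (d - 1)) ^ N = (b ^ N) ^ (1 - d) := by
            rw [hb, ← Real.rpow_natCast, ← Real.rpow_natCast, ← Real.rpow_mul hl0.le,
              ← Real.rpow_mul (by positivity), Real.inv_rpow hl0.le, ← Real.rpow_neg hl0.le]
            congr 1
            ring
          have e2 : ρ ^ (-(t * q)) * (H * (l ^ (d - 1)) ^ N * ρ) ^ (q - 1) * (V * ρ) =
              K * (b ^ N * ρ) ^ (q - t * q) := by
            have hbN : 0 < b ^ N := by positivity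
            rw [e1, Real.mul_rpow (by positivity) hρ0.le, Real.mul_rpow hH.le (by positivity),
              ← Real.rpow_mul hbN.le, show (1 - d) * (q - 1) = q - t * q by linarith,
              Real.mul_rpow hbN.le hρ0.le, Real.rpow_neg hρ0.le, Real.rpow_sub hρ0,
              Real.rpow_sub hρ0, Real.rpow_one, hK]
            field_simp
          rw [e2]
          gcongr
          -- The extra `1` comes from bounding `ρ` by the outer radius `b ^ (k + 1)` of the annulus;
          -- `k < -N` makes `m` nonnegative.
          obtain ⟨m, hm⟩ : ∃ m : ℕ, k + (N + 1) = -(m : ℤ) := ⟨(-(k + (N + 1))).toNat, by omega⟩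
          have e3 : b ^ N * ρ ≤ b ^ (-(m : ℤ)) := by
            calc b ^ N * ρ ≤ b ^ N * b ^ (k + 1) := by gcongr
              _ = _ := by
                rw [← zpow_natCast, ← zpow_add₀ hb0.ne', ← hm]
                congr 1
                ring
          calc _ ≤ (b ^ (-(m : ℤ))) ^ (q - t * q) :=
                Real.rpow_le_rpow (by positivity) e3 htq'.le
            _ = _ := by
              rw [hm, Int.natAbs_neg, Int.natAbs_natCast, hr₂, zpow_neg, zpow_natCast,
                Real.inv_rpow (by positivity), ← Real.rpow_neg (by positivity),
                ← Real.rpow_natCast, ← Real.rpow_natCast, ← Real.rpow_mul hb0.le,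
                ← Real.rpow_mul hb0.le, mul_comm]
        · gcongr
          rw [add_assoc]
          exact le_add_left le_self_add
  have hpt : ∀ h ∈ An, ∑' k : ℤ,
      ENNReal.ofReal ((b ^ k) ^ Module.finrank ℝ (EuclideanSpace ℝ (Fin n))) *
        ∫⁻ x, ENNReal.ofReal (diffQuot (t + (n : ℝ) / q) u (x, b ^ k • h) ^ q) ≤
      ENNReal.ofReal (K * (c₁ + c₂ + N)) := by
    intro h hh
    refine (ENNReal.tsum_le_tsum (hterm h hh)).trans ?_
    rw [ENNReal.tsum_mul_left, ENNReal.tsum_add, ENNReal.tsum_add,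
      tsum_int_ofReal_pow_natAbs hr₁0.le hr₁1, tsum_int_ofReal_pow_natAbs hr₂0.le hr₂1,
      ENNReal.ofReal_mul hK0.le, ENNReal.ofReal_add (by positivity) (by positivity),
      ENNReal.ofReal_add hc₁0 hc₂0]
    gcongr
    rw [← tsum_subtype ((Finset.Ico (-(N : ℤ)) 0 : Finset ℤ) : Set ℤ) (1 : ℤ → ℝ≥0∞),
      Finset.tsum_subtype']
    simp
  calc _ ≤ ∫⁻ _ in An, ENNReal.ofReal (K * (c₁ + c₂ + N)) := setLIntegral_mono' hAnm hpt
    _ = ENNReal.ofReal (K * (c₁ + c₂ + N)) * volume An := setLIntegral_const _ _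
    _ ≤ ENNReal.ofReal (K * (c₁ + c₂ + N)) * ENNReal.ofReal ((volume An).toReal + 1) := by
        gcongr
        conv_lhs => rw [← ENNReal.ofReal_toReal hAnfin.ne]
        exact ENNReal.ofReal_le_ofReal (by linarith)
    _ ≤ _ := by
        rw [← ENNReal.ofReal_mul (by positivity)]
        apply ENNReal.ofReal_le_ofReal
        have hN0 : (0 : ℝ) ≤ N := Nat.cast_nonneg N
        calc _ = K * ((volume An).toReal + 1) * (c₁ + c₂ + N) := by ring
          _ ≤ K * ((volume An).toReal + 1) * ((c₁ + c₂ + 1) * (N + 1)) := by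
            gcongr
            nlinarith
          _ = _ := by ring

end SobolevBound

/-! ### Total variation of smooth functions. -/

section BVBound

variable {n : ℕ}

theorem continuous_fderiv_apply_const {E : Type*} [NormedAddCommGroup E] [NormedSpace ℝ E]
    {f : E → ℝ} (hf : ContDiff ℝ 1 f) (v : E) : Continuous fun x => fderiv ℝ f x v :=
  (hf.continuous_fderiv one_ne_zero).clm_apply continuous_const

theorem integral_mul_fderiv_eq_neg {f g : EuclideanSpace ℝ (Fin n) → ℝ} (hf : ContDiff ℝ 1 f)
    (hg : ContDiff ℝ 1 g) (hc : HasCompactSupport g) (v : EuclideanSpace ℝ (Fin n)) :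
    ∫ x, f x * fderiv ℝ g x v = - ∫ x, fderiv ℝ f x v * g x := by
  refine integral_mul_fderiv_eq_neg_fderiv_mul_of_integrable ?_ ?_ ?_
    (fun x _ => hf.differentiable one_ne_zero x) (fun x _ => hg.differentiable one_ne_zero x)
  · exact ((continuous_fderiv_apply_const hf v).mul hg.continuous).integrable_of_hasCompactSupport
      hc.mul_left
  · exact (hf.continuous.mul (continuous_fderiv_apply_const hg v)).integrable_of_hasCompactSupport
      (hc.fderiv_apply (𝕜 := ℝ) v).mul_left
  · exact (hf.continuous.mul hg.continuous).integrable_of_hasCompactSupport hc.mul_left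

/-- The total variation of a `C¹` function is controlled by its partial derivatives. -/
theorem bvNorm_le_sum_lintegral {u : EuclideanSpace ℝ (Fin n) → ℝ} (hu : ContDiff ℝ 1 u) :
    bvNorm u ≤ ∑ j : Fin n, ∫⁻ x, ENNReal.ofReal |fderiv ℝ u x (EuclideanSpace.single j 1)| := by
  refine iSup_le fun φ => iSup_le fun hφ => iSup_le fun hφc => iSup_le fun hφ1 => ?_
  have hcomp : ∀ j : Fin n, ContDiff ℝ 1 fun y => φ y j := fun j =>
    (EuclideanSpace.proj j : EuclideanSpace ℝ (Fin n) →L[ℝ] ℝ).contDiff.comp hφ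
  have hcc : ∀ j : Fin n, HasCompactSupport fun y => φ y j := fun j =>
    hφc.comp_left (g := fun y : EuclideanSpace ℝ (Fin n) => y j) rfl
  have hfd : ∀ (j : Fin n) x, (fderiv ℝ φ x (EuclideanSpace.single j 1)) j =
      fderiv ℝ (fun y => φ y j) x (EuclideanSpace.single j 1) := by
    intro j x
    have h1 := ((EuclideanSpace.proj j : EuclideanSpace ℝ (Fin n) →L[ℝ] ℝ).hasFDerivAt.comp x
      (hφ.differentiable one_ne_zero x).hasFDerivAt).fderiv
    have h2 : fderiv ℝ (fun y => φ y j) x =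
      (EuclideanSpace.proj j : EuclideanSpace ℝ (Fin n) →L[ℝ] ℝ).comp (fderiv ℝ φ x) := h1
    rw [h2]
    rfl
  have hint : ∀ j ∈ Finset.univ, Integrable fun x =>
      u x * fderiv ℝ (fun y => φ y j) x (EuclideanSpace.single j 1) := fun j _ =>
    (hu.continuous.mul (continuous_fderiv_apply_const (hcomp j) _)).integrable_of_hasCompactSupport
      ((hcc j).fderiv_apply (𝕜 := ℝ) _).mul_left
  have heq : ∫ x, u x * divergence φ x =
      ∑ j : Fin n, -∫ x, fderiv ℝ u x (EuclideanSpace.single j 1) * φ x j := by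
    simp only [divergence, hfd, Finset.mul_sum]
    rw [integral_finsetSum _ hint]
    exact Finset.sum_congr rfl fun j _ => integral_mul_fderiv_eq_neg hu (hcomp j) (hcc j) _
  rw [heq]
  calc _ ≤ ENNReal.ofReal (∑ j : Fin n,
        |∫ x, fderiv ℝ u x (EuclideanSpace.single j 1) * φ x j|) := by
        apply ENNReal.ofReal_le_ofReal
        refine (Finset.abs_sum_le_sum_abs _ _).trans_eq ?_
        simp_rw [abs_neg]
    _ = ∑ j : Fin n, ENNReal.ofReal
        |∫ x, fderiv ℝ u x (EuclideanSpace.single j 1) * φ x j| :=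
        ENNReal.ofReal_sum_of_nonneg fun j _ => abs_nonneg _
    _ ≤ _ := by
        refine Finset.sum_le_sum fun j _ => ?_
        rw [← Real.enorm_eq_ofReal_abs]
        refine (enorm_integral_le_lintegral_enorm _).trans (lintegral_mono fun x => ?_)
        simp only
        rw [Real.enorm_eq_ofReal_abs, abs_mul]
        apply ENNReal.ofReal_le_ofReal
        refine mul_le_of_le_one_right (abs_nonneg _) ?_
        exact (PiLp.norm_apply_le (φ x) j).trans (hφ1 x)

end BVBound

/-! ### Uniform bounds for the localized staircase. -/

/-- A smooth Cantor staircase in the `i`-th variable, cut off by a bump function. -/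
noncomputable def cantorProfile {n : ℕ} (i : Fin n) (η : ContDiffBump (0 : EuclideanSpace ℝ (Fin n)))
    (α l : ℝ) (N : ℕ) (x : EuclideanSpace ℝ (Fin n)) : ℝ :=
  smoothCantor α l N (x i) * η x

section CantorProfile

variable {n : ℕ} (i : Fin n) (η : ContDiffBump (0 : EuclideanSpace ℝ (Fin n))) {α l : ℝ}

theorem contDiff_smoothCantor_coord (α l : ℝ) (N : ℕ) :
    ContDiff ℝ ∞ fun x : EuclideanSpace ℝ (Fin n) => smoothCantor α l N (x i) :=
  (contDiff_smoothCantor α l N).comp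
    (EuclideanSpace.proj i : EuclideanSpace ℝ (Fin n) →L[ℝ] ℝ).contDiff

theorem contDiff_cantorProfile (α l : ℝ) (N : ℕ) : ContDiff ℝ ∞ (cantorProfile i η α l N) :=
  (contDiff_smoothCantor_coord i α l N).mul η.contDiff

theorem hasCompactSupport_cantorProfile (α l : ℝ) (N : ℕ) :
    HasCompactSupport (cantorProfile i η α l N) :=
  η.hasCompactSupport.mul_left

theorem fderiv_smoothCantor_coord (α l : ℝ) (N : ℕ) (x : EuclideanSpace ℝ (Fin n)) (j : Fin n) :
    fderiv ℝ (fun x : EuclideanSpace ℝ (Fin n) => smoothCantor α l N (x i)) x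
      (EuclideanSpace.single j 1) = if i = j then deriv (smoothCantor α l N) (x i) else 0 := by
  have h1 : HasDerivAt (smoothCantor α l N) (deriv (smoothCantor α l N) (x i)) (x i) :=
    ((contDiff_smoothCantor α l N).differentiable (by simp) _).hasDerivAt
  have h2 := (EuclideanSpace.proj i : EuclideanSpace ℝ (Fin n) →L[ℝ] ℝ).hasFDerivAt (x := x)
  have h3 := (h1.comp_hasFDerivAt x h2).fderiv
  have h4 : fderiv ℝ (fun x : EuclideanSpace ℝ (Fin n) => smoothCantor α l N (x i)) x =
    deriv (smoothCantor α l N) (x i) •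
      (EuclideanSpace.proj i : EuclideanSpace ℝ (Fin n) →L[ℝ] ℝ) := h3
  rw [h4]
  simp

/-- The staircase is monotone, so its derivative needs no absolute value and can be integrated by
parts onto the cutoff; since its values lie in `[0,1]`, the bound does not see `N`. -/
theorem lintegral_fderiv_cantorProfile_le (hα0 : 0 ≤ α) (hα1 : α ≤ 1) (hl0 : 0 < l)
    (hl : l < 1 / 2) (N : ℕ) (j : Fin n) :
    ∫⁻ x, ENNReal.ofReal |fderiv ℝ (cantorProfile i η α l N) x (EuclideanSpace.single j 1)| ≤
      ENNReal.ofReal ((∫ x, |fderiv ℝ η x (EuclideanSpace.single i 1)|) +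
        ∫ x, |fderiv ℝ η x (EuclideanSpace.single j 1)|) := by
  set G : EuclideanSpace ℝ (Fin n) → ℝ := fun x => smoothCantor α l N (x i) with hG
  have hGC : ContDiff ℝ 1 G := (contDiff_smoothCantor_coord i α l N).of_le (by simp)
  have hηC : ContDiff ℝ 1 η := η.contDiff
  have hG0 : ∀ x, 0 ≤ G x := fun x => smoothCantor_nonneg hα0 hα1 hl0 hl N _
  have hG1 : ∀ x, G x ≤ 1 := fun x => smoothCantor_le_one hα0 hα1 hl0 hl N _
  have hder : ∀ x : EuclideanSpace ℝ (Fin n), 0 ≤ deriv (smoothCantor α l N) (x i) := fun x =>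
    (monotone_smoothCantor hα0 hα1 hl0 N).deriv_nonneg
  have hGi : ∀ x, fderiv ℝ G x (EuclideanSpace.single i 1) = deriv (smoothCantor α l N) (x i) := by
    intro x
    rw [hG, fderiv_smoothCantor_coord, if_pos rfl]
  have hint : ∀ k : Fin n, Integrable fun x => |fderiv ℝ η x (EuclideanSpace.single k 1)| := fun k =>
    ((continuous_fderiv_apply_const hηC _).integrable_of_hasCompactSupport
      (η.hasCompactSupport.fderiv_apply (𝕜 := ℝ) _)).abs
  have hint2 : Integrable fun x => fderiv ℝ G x (EuclideanSpace.single i 1) * η x :=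
    ((continuous_fderiv_apply_const hGC _).mul hηC.continuous).integrable_of_hasCompactSupport
      η.hasCompactSupport.mul_left
  have hpt : ∀ x, |fderiv ℝ (cantorProfile i η α l N) x (EuclideanSpace.single j 1)| ≤
      fderiv ℝ G x (EuclideanSpace.single i 1) * η x +
        |fderiv ℝ η x (EuclideanSpace.single j 1)| := by
    intro x
    have h1 := ((hGC.differentiable one_ne_zero x).hasFDerivAt.mul
      (hηC.differentiable one_ne_zero x).hasFDerivAt).fderiv
    have h2 : fderiv ℝ (cantorProfile i η α l N) x = G x • fderiv ℝ η x + η x • fderiv ℝ G x := h1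
    rw [h2]
    simp only [add_apply, smul_apply, smul_eq_mul]
    refine (abs_add_le _ _).trans ?_
    rw [add_comm, abs_mul, abs_mul, abs_of_nonneg (hG0 x), abs_of_nonneg η.nonneg, mul_comm (η x)]
    refine add_le_add (mul_le_mul_of_nonneg_right ?_ η.nonneg) ?_
    · rw [hGi, hG, fderiv_smoothCantor_coord]
      split_ifs
      · rw [abs_of_nonneg (hder x)]
      · rw [abs_zero]
        exact hder x
    · exact mul_le_of_le_one_left (abs_nonneg _) (hG1 x)
  have hparts : ∫ x, fderiv ℝ G x (EuclideanSpace.single i 1) * η x ≤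
      ∫ x, |fderiv ℝ η x (EuclideanSpace.single i 1)| := by
    have h1 := integral_mul_fderiv_eq_neg hGC hηC η.hasCompactSupport (EuclideanSpace.single i 1)
    have h2 : ∫ x, fderiv ℝ G x (EuclideanSpace.single i 1) * η x =
      - ∫ x, G x * fderiv ℝ η x (EuclideanSpace.single i 1) := by rw [h1, neg_neg]
    rw [h2]
    refine (neg_le_abs _).trans ((abs_integral_le_integral_abs).trans ?_)
    refine integral_mono_of_nonneg (Filter.Eventually.of_forall fun x => abs_nonneg _) (hint i)
      (Filter.Eventually.of_forall fun x => ?_)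
    simp only
    rw [abs_mul, abs_of_nonneg (hG0 x)]
    exact mul_le_of_le_one_left (abs_nonneg _) (hG1 x)
  calc _ ≤ ∫⁻ x, ENNReal.ofReal (fderiv ℝ G x (EuclideanSpace.single i 1) * η x +
        |fderiv ℝ η x (EuclideanSpace.single j 1)|) :=
        lintegral_mono fun x => ENNReal.ofReal_le_ofReal (hpt x)
    _ = ENNReal.ofReal (∫ x, (fderiv ℝ G x (EuclideanSpace.single i 1) * η x +
        |fderiv ℝ η x (EuclideanSpace.single j 1)|)) := by
        rw [ofReal_integral_eq_lintegral_ofReal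
          (f := fun x => fderiv ℝ G x (EuclideanSpace.single i 1) * η x +
            |fderiv ℝ η x (EuclideanSpace.single j 1)|) (hint2.add (hint j))]
        exact Filter.Eventually.of_forall fun x => (abs_nonneg _).trans (hpt x)
    _ ≤ _ := by
        apply ENNReal.ofReal_le_ofReal
        rw [integral_add hint2 (hint j)]
        gcongr

theorem abs_cantorProfile_sub_le (hα0 : 0 ≤ α) (hα1 : α ≤ 1) (hl0 : 0 < l) (hl : l < 1 / 2) (N : ℕ)
    (x h : EuclideanSpace ℝ (Fin n)) :
    |cantorProfile i η α l N (x + h) - cantorProfile i η α l N x| ≤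
      |smoothCantor α l N (x i + h i) - smoothCantor α l N (x i)| + |η (x + h) - η x| := by
  have h1 : cantorProfile i η α l N (x + h) - cantorProfile i η α l N x =
      (smoothCantor α l N (x i + h i) - smoothCantor α l N (x i)) * η (x + h) +
        smoothCantor α l N (x i) * (η (x + h) - η x) := by
    simp only [cantorProfile, PiLp.add_apply]
    ring
  rw [h1]
  refine (abs_add_le _ _).trans ?_
  rw [abs_mul, abs_mul, abs_of_nonneg (η.nonneg (x := x + h)),
    abs_of_nonneg (smoothCantor_nonneg hα0 hα1 hl0 hl N _)]
  exact add_le_add (mul_le_of_le_one_right (abs_nonneg _) η.le_one)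
    (mul_le_of_le_one_left (abs_nonneg _) (smoothCantor_le_one hα0 hα1 hl0 hl N _))

theorem cantorProfile_mem_Icc (hα0 : 0 ≤ α) (hα1 : α ≤ 1) (hl0 : 0 < l) (hl : l < 1 / 2) (N : ℕ)
    (x : EuclideanSpace ℝ (Fin n)) :
    0 ≤ cantorProfile i η α l N x ∧ cantorProfile i η α l N x ≤ η x :=
  ⟨mul_nonneg (smoothCantor_nonneg hα0 hα1 hl0 hl N _) η.nonneg,
    mul_le_of_le_one_left η.nonneg (smoothCantor_le_one hα0 hα1 hl0 hl N _)⟩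

/-- The cutoff is bounded and Lipschitz, so the profile inherits the Hölder and Lipschitz bounds of
the staircase. The `L^1` translation bounds come from the total variation for small `h` and from
twice the mass of the cutoff for large `h`. -/
theorem exists_norm_cantorProfile_le {t q d : ℝ} (ht0 : 0 < t) (ht1 : t < 1) (hq : 1 < q)
    (hd0 : 0 ≤ d) (hd1 : d ≤ 1) (hd : d * (q - 1) = t * q - 1) (hl0 : 0 < l) (hl : l < 1 / 2)
    (hα0 : 1 / 2 ≤ α) (hα1 : α ≤ 1) (hα : α = l ^ d) :
    ∃ C : ℝ, 0 < C ∧ ∀ N : ℕ,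
      fracSobolevNorm t q (cantorProfile i η α l N) ^ q ≤ ENNReal.ofReal (C * (N + 1)) ∧
      bvNorm (cantorProfile i η α l N) ≤ ENNReal.ofReal C := by
  have hn : 1 ≤ n := i.pos
  have hα0' : 0 ≤ α := by linarith
  obtain ⟨H, hH1, hH⟩ := exists_smoothCantor_sub_le hd0 hd1 hl0 hl hα0 hα1 hα
  obtain ⟨L, hL⟩ := (η.contDiff (n := 1)).lipschitzWith_of_hasCompactSupport η.hasCompactSupport
    one_ne_zero
  have hL : ∀ x h, |η (x + h) - η x| ≤ L * ‖h‖ := by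
    intro x h
    have := hL.dist_le_mul (x + h) x
    rwa [Real.dist_eq, dist_self_add_left] at this
  have hη1 : ∀ x h, |η (x + h) - η x| ≤ 1 := by
    intro x h
    rw [abs_le]
    constructor <;> linarith [η.nonneg (x := x), η.le_one (x := x), η.nonneg (x := x + h),
      η.le_one (x := x + h)]
  have hL0 : (0 : ℝ) ≤ L := L.2
  have hαl : α / l = l ^ (d - 1) := by
    rw [Real.rpow_sub hl0, Real.rpow_one, hα]
  have hαl1 : 1 ≤ α / l := by
    rw [one_le_div hl0]
    linarith
  have hinc : ∀ N (a b : ℝ), |smoothCantor α l N (a + b) - smoothCantor α l N a| ≤ H * |b| ^ d ∧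
      |smoothCantor α l N (a + b) - smoothCantor α l N a| ≤ H * (α / l) ^ N * |b| := by
    intro N a b
    rcases le_total 0 b with hb | hb
    · obtain ⟨h1, h2⟩ := hH N a (a + b) (by linarith)
      have hm := monotone_smoothCantor hα0' hα1 hl0 N (by linarith : a ≤ a + b)
      rw [add_sub_cancel_left] at h1 h2
      rw [abs_of_nonneg (sub_nonneg.2 hm), abs_of_nonneg hb]
      exact ⟨h1, h2⟩
    · obtain ⟨h1, h2⟩ := hH N (a + b) a (by linarith)
      have hm := monotone_smoothCantor hα0' hα1 hl0 N (by linarith : a + b ≤ a)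
      rw [sub_add_cancel_left] at h1 h2
      rw [abs_sub_comm, abs_of_nonneg (sub_nonneg.2 hm), abs_of_nonpos hb]
      exact ⟨h1, h2⟩
  have hcoord : ∀ h : EuclideanSpace ℝ (Fin n), |h i| ≤ ‖h‖ := fun h => PiLp.norm_apply_le h i
  set H' : ℝ := H + L + 1 with hH'
  set V₁ : ℝ := ∑ j : Fin n, ((∫ x, |fderiv ℝ η x (EuclideanSpace.single i 1)|) +
        ∫ x, |fderiv ℝ η x (EuclideanSpace.single j 1)|) with hV₁
  have hnn : ∀ j : Fin n, 0 ≤ ∫ x, |fderiv ℝ η x (EuclideanSpace.single j 1)| := fun j =>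
    integral_nonneg fun x => abs_nonneg _
  have hV₁0 : 0 ≤ V₁ := Finset.sum_nonneg fun j _ => add_nonneg (hnn i) (hnn j)
  have hη0 : 0 ≤ ∫ x, η x := integral_nonneg fun x => η.nonneg
  have hηint : Integrable (fun x => η x) volume :=
    (η.contDiff (n := 0)).continuous.integrable_of_hasCompactSupport η.hasCompactSupport
  set V : ℝ := V₁ + 2 * (∫ x, η x) + 1 with hV
  have hV0 : 0 < V := by positivity
  obtain ⟨C, hC0, hC⟩ := exists_lintegral_diffQuot_rpow_le hn ht0 ht1 hq hd hl0
    (by linarith) (by positivity : 0 < H') hV0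
  have hbv : ∀ N, bvNorm (cantorProfile i η α l N) ≤ ENNReal.ofReal V₁ := by
    intro N
    refine (bvNorm_le_sum_lintegral ((contDiff_cantorProfile i η α l N).of_le (by simp))).trans ?_
    rw [hV₁, ENNReal.ofReal_sum_of_nonneg fun j _ => add_nonneg (hnn i) (hnn j)]
    exact Finset.sum_le_sum fun j _ => lintegral_fderiv_cantorProfile_le i η hα0' hα1 hl0 hl N j
  refine ⟨C + V₁, by positivity, fun N => ⟨?_, (hbv N).trans (ENNReal.ofReal_le_ofReal
    (by linarith))⟩⟩
  have hcont := (contDiff_cantorProfile i η α l N).continuous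
  have hli : LocallyIntegrable (cantorProfile i η α l N) volume := hcont.locallyIntegrable
  refine (hC _ N hcont.measurable ?_ ?_ ?_ ?_ ?_).trans (ENNReal.ofReal_le_ofReal ?_)
  · intro x h
    obtain ⟨h1, h2⟩ := cantorProfile_mem_Icc i η hα0' hα1 hl0 hl N x
    obtain ⟨h3, h4⟩ := cantorProfile_mem_Icc i η hα0' hα1 hl0 hl N (x + h)
    have h5 := η.le_one (x := x)
    have h6 := η.le_one (x := x + h)
    rw [abs_le]
    constructor <;> linarith
  · intro x h
    refine (abs_cantorProfile_sub_le i η hα0' hα1 hl0 hl N x h).trans ?_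
    have h1 : H * |h i| ^ d ≤ H * ‖h‖ ^ d := by
      gcongr
      exact hcoord h
    -- The Lipschitz bound is used for `‖h‖ ≤ 1`, the bound by `1` otherwise.
    have h2 : |η (x + h) - η x| ≤ (L + 1) * ‖h‖ ^ d := by
      have hd0' : 0 ≤ ‖h‖ ^ d := by positivity
      rcases le_total ‖h‖ 1 with hh | hh
      · have h3 := Real.self_le_rpow_of_le_one (norm_nonneg h) hh hd1
        have h4 := hL x h
        nlinarith
      · have h3 := Real.one_le_rpow hh hd0
        have h4 := hη1 x h
        nlinarith
    have h5 := (hinc N (x i) (h i)).1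
    rw [hH']
    linarith
  · intro x h
    refine (abs_cantorProfile_sub_le i η hα0' hα1 hl0 hl N x h).trans ?_
    rw [← hαl]
    have hp : 1 ≤ (α / l) ^ N := one_le_pow₀ hαl1
    have h1 : H * (α / l) ^ N * |h i| ≤ H * (α / l) ^ N * ‖h‖ := by
      gcongr
      exact hcoord h
    have h2 : L * ‖h‖ ≤ (L + 1) * (α / l) ^ N * ‖h‖ := by
      gcongr
      nlinarith
    have h5 := (hinc N (x i) (h i)).2
    have h6 := hL x h
    rw [hH']
    linarith
  · intro h
    calc _ ≤ ∫⁻ x, ENNReal.ofReal (η (x + h) + η x) := by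
          refine lintegral_mono fun x => ENNReal.ofReal_le_ofReal ?_
          obtain ⟨h1, h2⟩ := cantorProfile_mem_Icc i η hα0' hα1 hl0 hl N x
          obtain ⟨h3, h4⟩ := cantorProfile_mem_Icc i η hα0' hα1 hl0 hl N (x + h)
          rw [abs_le]
          constructor <;> linarith
      _ = ENNReal.ofReal (∫ x, (η (x + h) + η x)) := by
          rw [ofReal_integral_eq_lintegral_ofReal (f := fun x => η (x + h) + η x)
            ((hηint.comp_add_right h).add hηint)]
          exact Filter.Eventually.of_forall fun x => add_nonneg η.nonneg η.nonneg
      _ ≤ _ := by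
          apply ENNReal.ofReal_le_ofReal
          rw [integral_add (hηint.comp_add_right h) hηint,
            integral_add_right_eq_self (fun x => η x) h]
          linarith
  · intro h
    refine (lintegral_abs_sub_translate_le_bvNorm hli h).trans ?_
    rw [mul_comm V, ENNReal.ofReal_mul (norm_nonneg h)]
    gcongr
    exact (hbv N).trans (ENNReal.ofReal_le_ofReal (by linarith))
  · gcongr
    linarith

end CantorProfile

/-! ### Size of the superlevel sets at each scale. -/

/-- This and the next lemma compare powers of `‖h‖` with powers of the scale when the sign of the
exponent is unknown. -/
theorem Real.min_one_rpow_le {m M : ℝ} (e : ℝ) (h1 : 1 ≤ m) (hM : m ≤ M) :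
    min 1 (M ^ e) ≤ m ^ e := by
  rcases le_total 0 e with he | he
  · exact (min_le_left _ _).trans (Real.one_le_rpow h1 he)
  · exact (min_le_right _ _).trans (Real.rpow_le_rpow_of_nonpos (by linarith) hM he)

theorem Real.rpow_le_max_one {m M : ℝ} (e : ℝ) (h1 : 1 ≤ m) (hM : m ≤ M) :
    m ^ e ≤ max 1 (M ^ e) := by
  rcases le_total 0 e with he | he
  · exact (Real.rpow_le_rpow (by linarith) hM he).trans (le_max_right _ _)
  · exact (Real.rpow_le_one_of_one_le_of_nonpos h1 he).trans (le_max_left _ _)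

theorem EuclideanSpace.volume_box {n : ℕ} (i : Fin n) {A B : Set ℝ} (hA : MeasurableSet A)
    (hB : MeasurableSet B) :
    volume {x : EuclideanSpace ℝ (Fin n) | x i ∈ A ∧ ∀ j, j ≠ i → x j ∈ B} =
      volume A * volume B ^ (n - 1) := by
  have hset : {x : EuclideanSpace ℝ (Fin n) | x i ∈ A ∧ ∀ j, j ≠ i → x j ∈ B} =
      (WithLp.ofLp) ⁻¹' (Set.univ.pi fun j => if j = i then A else B) := by
    ext x
    simp only [Set.mem_ofPred_eq, Set.mem_preimage, Set.mem_univ_pi]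
    constructor
    · rintro ⟨h1, h2⟩ j
      split_ifs with hj
      · rwa [hj]
      · exact h2 j hj
    · intro h
      refine ⟨by simpa using h i, fun j hj => by simpa [hj] using h j⟩
  have hm : MeasurableSet (Set.univ.pi fun j : Fin n => if j = i then A else B) :=
    MeasurableSet.univ_pi fun j => by split_ifs <;> assumption
  rw [hset, (PiLp.volume_preserving_ofLp (Fin n)).measure_preimage hm.nullMeasurableSet,
    volume_pi_pi, Fintype.prod_eq_mul_prod_compl i, if_pos rfl]
  congr 1
  rw [Finset.prod_congr rfl (g := fun _ => volume B), Finset.prod_const]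
  · simp [Finset.card_compl]
  · intro j hj
    rw [if_neg (by simpa using hj)]

theorem EuclideanSpace.norm_le_card_mul {n : ℕ} {x : EuclideanSpace ℝ (Fin n)} {c : ℝ}
    (h : ∀ j, |x j| ≤ c) : ‖x‖ ≤ n * c := by
  have hx : x = ∑ j, x j • EuclideanSpace.single j (1 : ℝ) := by
    have := (EuclideanSpace.basisFun (Fin n) ℝ).sum_repr x
    simpa using this.symm
  rw [hx]
  refine (norm_sum_le _ _).trans ?_
  calc _ ≤ ∑ _j : Fin n, c := by
        refine Finset.sum_le_sum fun j _ => ?_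
        rw [norm_smul]
        simpa using h j
    _ = n * c := by simp

section LowerBound

variable {n : ℕ} (i : Fin n) (η : ContDiffBump (0 : EuclideanSpace ℝ (Fin n))) {α l : ℝ}

/-- At each scale `l ^ k` the difference quotients of the Cantor profile are large on a set of the
critical size. -/
theorem exists_le_nuMeasure_cantorProfile (hη : 4 * (n : ℝ) ≤ η.rIn) {d b γ : ℝ} (hl0 : 0 < l)
    (hl : l < 1 / 2) (hα : α = 1 / 2 ∨ α = 1) (hαd : α = l ^ d) :
    ∃ c c' : ℝ, 0 < c ∧ 0 < c' ∧ ∀ k M : ℕ, ∀ y : ℝ, y < c * (l ^ k) ^ (d - b) →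
      ENNReal.ofReal (c' * (l ^ k) ^ (γ + 1 - d)) ≤
        nuMeasure n γ {z | y < |diffQuot b (cantorProfile i η α l (k + M)) z|} := by
  have hn : 1 ≤ n := i.pos
  have hn' : (1 : ℝ) ≤ n := by exact_mod_cast hn
  have hα0 : 1 / 2 ≤ α := by rcases hα with h | h <;> linarith
  have hα1 : α ≤ 1 := by rcases hα with h | h <;> linarith
  obtain ⟨δ, hδ⟩ : ∃ δ : ℝ, δ = (1 - 2 * l) / 4 := ⟨_, rfl⟩
  have hδ0 : 0 < δ := by linarith
  have hδ1 : δ < 1 / 4 := by linarith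
  have hM0 : (0 : ℝ) < 2 * n := by linarith
  set m₁ : ℝ := max 1 ((2 * (n : ℝ)) ^ b) with hm₁
  set m₂ : ℝ := min 1 ((2 * (n : ℝ)) ^ (γ - n)) with hm₂
  have hm₁0 : 0 < m₁ := lt_max_of_lt_left one_pos
  have hm₂0 : 0 < m₂ := lt_min one_pos (by positivity)
  refine ⟨m₁⁻¹, m₂ * δ * δ, by positivity, by positivity, fun k M y hy => ?_⟩
  set L : ℝ := l ^ k with hL
  have hL0 : 0 < L := by positivity
  have hL1 : L ≤ 1 := pow_le_one₀ hl0.le (by linarith)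
  have hαk : α ^ k = L ^ d := by
    rw [hαd, hL, ← Real.rpow_natCast, ← Real.rpow_natCast, ← Real.rpow_mul hl0.le,
      ← Real.rpow_mul hl0.le, mul_comm]
  have hlαk : (l / α) ^ k = L ^ (1 - d) := by
    rw [div_pow, hαk, Real.rpow_sub hL0, Real.rpow_one]
  set u := cantorProfile i η α l (k + M) with hu
  have hum : Measurable u := (contDiff_cantorProfile i η α l (k + M)).continuous.measurable
  have hSm : MeasurableSet {z | y < |diffQuot b u z|} :=
    measurableSet_lt measurable_const (measurable_diffQuot hum b).abs
  -- A box of increments with `‖h‖` between `L` and `2 * n * L`. Its volume `δ * L ^ n`, the density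
  -- of order `L ^ (γ - n)` and sections in `x` of measure at least `δ * L ^ (1 - d)` multiply to
  -- order `L ^ (γ + 1 - d)`.
  set Hk : Set (EuclideanSpace ℝ (Fin n)) := {h | h i ∈ Set.Icc (L * (1 + δ)) (L * (1 + 2 * δ)) ∧
    ∀ j, j ≠ i → h j ∈ Set.Icc 0 L} with hHk
  have hcoordm : ∀ j : Fin n, Measurable fun x : EuclideanSpace ℝ (Fin n) => x j := fun j =>
    (EuclideanSpace.proj j : EuclideanSpace ℝ (Fin n) →L[ℝ] ℝ).continuous.measurable
  have hHkm : MeasurableSet Hk := by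
    have : Hk = (fun h => h i) ⁻¹' Set.Icc (L * (1 + δ)) (L * (1 + 2 * δ)) ∩
        ⋂ j, ⋂ (_ : j ≠ i), (fun h : EuclideanSpace ℝ (Fin n) => h j) ⁻¹' Set.Icc 0 L := by
      ext h
      simp [hHk]
    rw [this]
    exact (hcoordm i measurableSet_Icc).inter
      (MeasurableSet.iInter fun j => MeasurableSet.iInter fun _ => hcoordm j measurableSet_Icc)
  have hvolH : volume Hk = ENNReal.ofReal (δ * L ^ n) := by
    rw [hHk, EuclideanSpace.volume_box i measurableSet_Icc measurableSet_Icc, Real.volume_Icc,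
      Real.volume_Icc, ← ENNReal.ofReal_pow (by linarith), ← ENNReal.ofReal_mul (by nlinarith)]
    congr 1
    obtain ⟨n', rfl⟩ : ∃ n', n = n' + 1 := ⟨n - 1, by omega⟩
    rw [Nat.add_sub_cancel, pow_succ]
    ring
  have hsec : ∀ h ∈ Hk, ENNReal.ofReal (m₂ * L ^ (γ - n) * (δ * L ^ (1 - d))) ≤
      ENNReal.ofReal (‖h‖ ^ (γ - (n : ℝ))) *
        volume {x : EuclideanSpace ℝ (Fin n) | (x, h) ∈ {z | y < |diffQuot b u z|}} := by
    intro h hh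
    have hi := hh.1
    have hhabs : ∀ j, |h j| ≤ L * 2 := by
      intro j
      by_cases hj : j = i
      · rw [hj, abs_of_nonneg (le_trans (by positivity) hi.1)]
        exact hi.2.trans (by gcongr; linarith)
      · have := hh.2 j hj
        rw [abs_of_nonneg this.1]
        linarith [this.2]
    have hnorm2 : ‖h‖ ≤ L * (2 * n) := by
      have := EuclideanSpace.norm_le_card_mul hhabs
      linarith
    have hnorm1 : L ≤ ‖h‖ := by
      have h1 : |h i| ≤ ‖h‖ := PiLp.norm_apply_le h i
      have h2 : L ≤ h i := le_trans (by nlinarith) hi.1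
      exact h2.trans ((le_abs_self _).trans h1)
    obtain ⟨m, hm⟩ : ∃ m, ‖h‖ = L * m := ⟨‖h‖ / L, by field_simp⟩
    have hm1 : 1 ≤ m := by
      rw [hm] at hnorm1
      exact (le_mul_iff_one_le_right hL0).1 hnorm1
    have hm2 : m ≤ 2 * n := by
      rw [hm] at hnorm2
      exact le_of_mul_le_mul_left hnorm2 hL0
    have hm0 : 0 < m := by linarith
    have hweight : m₂ * L ^ (γ - n) ≤ ‖h‖ ^ (γ - (n : ℝ)) := by
      rw [hm, Real.mul_rpow hL0.le hm0.le, mul_comm]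
      gcongr
      exact Real.min_one_rpow_le _ hm1 hm2
    have hden : ‖h‖ ^ b ≤ m₁ * L ^ b := by
      rw [hm, Real.mul_rpow hL0.le hm0.le, mul_comm m₁]
      gcongr
      exact Real.rpow_le_max_one _ hm1 hm2
    set A : Set ℝ := {x : ℝ | x ∈ Set.Icc (-2 * δ) 1 ∧
      α ^ k ≤ smoothCantor α l (k + M) (x + h i) - smoothCantor α l (k + M) x} with hA
    have hAm : MeasurableSet A := by
      have hc := (contDiff_smoothCantor α l (k + M)).continuous
      exact measurableSet_Icc.inter (measurableSet_le measurable_const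
        (by fun_prop : Continuous fun x : ℝ => smoothCantor α l (k + M) (x + h i) -
          smoothCantor α l (k + M) x).measurable)
    have hvolA := le_volume_smoothCantor_increment hl0 hl hα hδ k M hi.1 hi.2
    have hsub : {x : EuclideanSpace ℝ (Fin n) | x i ∈ A ∧ ∀ j, j ≠ i → x j ∈ Set.Icc (0 : ℝ) 1} ⊆
        {x : EuclideanSpace ℝ (Fin n) | (x, h) ∈ {z | y < |diffQuot b u z|}} := by
      rintro x ⟨hxA, hxj⟩
      have hxabs : ∀ j, |x j| ≤ 1 := by
        intro j
        rw [abs_le]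
        by_cases hj : j = i
        · rw [hj]
          exact ⟨by linarith [hxA.1.1], hxA.1.2⟩
        · exact ⟨by linarith [(hxj j hj).1], (hxj j hj).2⟩
      -- Both `x` and `x + h` have coordinates at most `3` in absolute value, so the cutoff is
      -- invisible there.
      have hη1 : ∀ z : EuclideanSpace ℝ (Fin n), (∀ j, |z j| ≤ 4) → η z = 1 := by
        intro z hz
        apply η.one_of_mem_closedBall
        rw [mem_closedBall_zero_iff]
        have := EuclideanSpace.norm_le_card_mul hz
        linarith
      have e1 : η x = 1 := hη1 x fun j => (hxabs j).trans (by norm_num)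
      have e2 : η (x + h) = 1 := hη1 (x + h) fun j => by
        have h3 : (x + h) j = x j + h j := rfl
        rw [h3]
        refine (abs_add_le _ _).trans ?_
        linarith [hxabs j, hhabs j]
      have hdiff : u (x + h) - u x =
          smoothCantor α l (k + M) (x i + h i) - smoothCantor α l (k + M) (x i) := by
        simp only [hu, cantorProfile, e1, e2, mul_one, PiLp.add_apply]
      change y < |diffQuot b u (x, h)|
      rw [abs_of_nonneg (diffQuot_nonneg _ _ _)]
      refine hy.trans_le ?_
      have hnum : L ^ d ≤ |u (x + h) - u x| := by
        rw [hdiff, ← hαk]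
        exact hxA.2.trans (le_abs_self _)
      have hnp : 0 < ‖h‖ ^ b := Real.rpow_pos_of_pos (by linarith) b
      calc m₁⁻¹ * L ^ (d - b) = L ^ d / (m₁ * L ^ b) := by
            rw [Real.rpow_sub hL0]
            field_simp
        _ ≤ _ := div_le_div₀ (abs_nonneg _) hnum hnp hden
    have hvolX : ENNReal.ofReal (δ * L ^ (1 - d)) ≤ volume {x : EuclideanSpace ℝ (Fin n) |
        (x, h) ∈ {z | y < |diffQuot b u z|}} := by
      refine le_trans ?_ (measure_mono hsub)
      rw [EuclideanSpace.volume_box i hAm measurableSet_Icc, Real.volume_Icc, sub_zero,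
        ENNReal.ofReal_one, one_pow, mul_one, ← hlαk]
      exact hvolA
    rw [ENNReal.ofReal_mul (by positivity)]
    exact mul_le_mul' (ENNReal.ofReal_le_ofReal hweight) hvolX
  rw [nuMeasure_apply γ hSm]
  calc _ = ENNReal.ofReal (m₂ * L ^ (γ - n) * (δ * L ^ (1 - d))) * volume Hk := by
        rw [hvolH, ← ENNReal.ofReal_mul (by positivity)]
        congr 1
        rw [show γ + 1 - d = (γ - n) + (1 - d) + n by ring, Real.rpow_add hL0, Real.rpow_add hL0,
          Real.rpow_natCast]
        ring
    _ = ∫⁻ _ in Hk, ENNReal.ofReal (m₂ * L ^ (γ - n) * (δ * L ^ (1 - d))) :=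
        (setLIntegral_const _ _).symm
    _ ≤ _ := (setLIntegral_mono' hHkm hsec).trans (setLIntegral_le_lintegral _ _)

end LowerBound

/-! ### Lorentz quasi-norm from below, and failure for smaller `r`. -/

/-- A geometric sequence of levels, each carrying a superlevel set of the critical size, forces the
Lorentz quasi-norm to grow with the number of levels. -/
theorem exists_le_lorentzQuasiNorm_of_geometric {p r g c c' : ℝ} (hp : 0 < p) (hr : 0 < r)
    (hg : 0 < g) (hg1 : g ≠ 1) (hc : 0 < c) (hc' : 0 < c') :
    ∃ a : ℝ, 0 < a ∧ ∀ {X : Type} [MeasurableSpace X] (ν : Measure X) (f : X → ℝ) (N : ℕ),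
      (∀ k < N, ∀ y < c * g ^ k, ENNReal.ofReal (c' * (g ^ k) ^ (-p)) ≤ ν {x | y < |f x|}) →
      ENNReal.ofReal (a * N) ^ (1 / r) ≤ lorentzQuasiNorm p r ν f := by
  set ρ := min g g⁻¹ with hρ
  have hρ0 : 0 < ρ := lt_min hg (by positivity)
  have hρ1 : ρ < 1 := by
    rcases hg1.lt_or_gt with h | h
    · exact (min_le_left _ _).trans_lt h
    · exact (min_le_right _ _).trans_lt (inv_lt_one_of_one_lt₀ h)
  set m := min 1 (ρ⁻¹ ^ (1 - r)) with hm
  have hm0 : 0 < m := lt_min one_pos (by positivity)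
  set a₀ : ℝ := m * (1 - ρ) * c ^ r * c' ^ (r / p) with ha₀
  have h1ρ : 0 < 1 - ρ := by linarith
  have ha₀0 : 0 < a₀ := by positivity
  refine ⟨r * a₀, by positivity, fun ν f N h => ?_⟩
  unfold lorentzQuasiNorm
  refine ENNReal.rpow_le_rpow ?_ (by positivity)
  -- With `ρ = min g g⁻¹` these intervals are disjoint whether the levels increase or decrease. On
  -- each, `y ^ (r - 1) dy` has mass of order `g ^ (k r)`, against a measure factor of order `g ^
  -- (-k r)`, so each contributes at least `a₀`.
  set J : ℕ → Set ℝ := fun k => Set.Ioo (ρ * (c * g ^ k)) (c * g ^ k) with hJ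
  have hJm : ∀ k, MeasurableSet (J k) := fun k => measurableSet_Ioo
  have hJd : Pairwise (Function.onFun Disjoint J) := by
    refine (pairwise_disjoint_on J).2 fun k k' hk => Set.disjoint_left.2 fun x hx hx' => ?_
    rcases hg1.lt_or_gt with h1 | h1
    · have e1 : ρ = g := min_eq_left (h1.le.trans ((one_le_inv₀ hg).2 h1.le))
      have h2 : x < c * g ^ k' := hx'.2
      have h3 : ρ * (c * g ^ k) < x := hx.1
      have h4 : g ^ k' ≤ g ^ (k + 1) := pow_le_pow_of_le_one hg.le h1.le hk
      have h5 : c * g ^ k' ≤ c * g ^ (k + 1) := by gcongr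
      rw [e1] at h3
      rw [pow_succ] at h5
      linarith
    · have e1 : ρ = g⁻¹ := min_eq_right ((inv_le_one_of_one_le₀ h1.le).trans h1.le)
      have h2 : x < c * g ^ k := hx.2
      have h3 : ρ * (c * g ^ k') < x := hx'.1
      have h4 : g ^ (k + 1) ≤ g ^ k' := pow_le_pow_right₀ h1.le hk
      have h5 : c * g ^ k = g⁻¹ * (c * g ^ (k + 1)) := by
        rw [pow_succ]
        field_simp
      have h6 : g⁻¹ * (c * g ^ (k + 1)) ≤ g⁻¹ * (c * g ^ k') := by gcongr
      rw [e1] at h3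
      linarith
  have hint : ∀ k ∈ Finset.range N, ENNReal.ofReal a₀ ≤
      ∫⁻ y in J k, ENNReal.ofReal (y ^ (r - 1)) * ν {x | y < |f x|} ^ (r / p) := by
    intro k hk
    have hT : 0 < c * g ^ k := by positivity
    have hgk : 0 < g ^ k := by positivity
    set T := c * g ^ k with hTdef
    calc ENNReal.ofReal a₀ = ENNReal.ofReal (m * T ^ (r - 1) * (c' * (g ^ k) ^ (-p)) ^ (r / p)) *
          volume (J k) := by
          rw [Real.volume_Ioo, ← ENNReal.ofReal_mul (by positivity), ha₀]
          congr 1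
          rw [Real.mul_rpow hc'.le (by positivity), ← Real.rpow_mul hgk.le,
            show -p * (r / p) = -r by field_simp, Real.rpow_neg hgk.le, Real.rpow_sub hT,
            Real.rpow_one, hTdef, Real.mul_rpow hc.le hgk.le]
          field_simp
      _ = ∫⁻ _ in J k, ENNReal.ofReal (m * T ^ (r - 1) * (c' * (g ^ k) ^ (-p)) ^ (r / p)) :=
          (setLIntegral_const _ _).symm
      _ ≤ _ := by
          refine setLIntegral_mono' (hJm k) fun y hy => ?_
          have hy1 : ρ * T < y := hy.1
          have hy2 : y < T := hy.2
          have hy0 : 0 < y := lt_trans (by positivity) hy1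
          rw [ENNReal.ofReal_mul (by positivity),
            ← ENNReal.ofReal_rpow_of_nonneg (by positivity) (by positivity)]
          refine mul_le_mul' (ENNReal.ofReal_le_ofReal ?_)
            (ENNReal.rpow_le_rpow (h k (Finset.mem_range.1 hk) y hy2) (by positivity))
          have h1 : m ≤ (T / y) ^ (1 - r) := by
            refine Real.min_one_rpow_le _ ((one_le_div hy0).2 hy2.le) ?_
            rw [div_le_iff₀ hy0, inv_mul_eq_div, le_div_iff₀ hρ0]
            linarith
          have h2 : (T / y) ^ (1 - r) * T ^ (r - 1) = y ^ (r - 1) := by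
            rw [Real.div_rpow hT.le hy0.le, show r - 1 = -(1 - r) by ring, Real.rpow_neg hT.le,
              Real.rpow_neg hy0.le]
            have := (Real.rpow_pos_of_pos hT (1 - r)).ne'
            field_simp
          rw [← h2]
          gcongr
  rw [mul_assoc, ENNReal.ofReal_mul hr.le]
  gcongr
  calc ENNReal.ofReal (a₀ * N) = ∑ _k ∈ Finset.range N, ENNReal.ofReal a₀ := by
        rw [Finset.sum_const, Finset.card_range, nsmul_eq_mul, mul_comm,
          ENNReal.ofReal_mul (by positivity), ENNReal.ofReal_natCast]
    _ ≤ ∑ k ∈ Finset.range N,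
        ∫⁻ y in J k, ENNReal.ofReal (y ^ (r - 1)) * ν {x | y < |f x|} ^ (r / p) :=
        Finset.sum_le_sum hint
    _ = ∫⁻ y in ⋃ k ∈ Finset.range N, J k,
        ENNReal.ofReal (y ^ (r - 1)) * ν {x | y < |f x|} ^ (r / p) :=
        (lintegral_biUnion_finset (fun k _ k' _ hkk => hJd hkk) (fun k _ => hJm k) _).symm
    _ ≤ _ := by
        refine lintegral_mono_set (Set.iUnion₂_subset fun k _ y hy => ?_)
        exact lt_trans (by positivity) hy.1

theorem exists_nat_mul_rpow_lt {A B a b : ℝ} (hA : 0 ≤ A) (hB : 0 < B) (ha : 0 < a) (hab : a < b) :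
    ∃ N : ℕ, A * ((N : ℝ) + 1) ^ a < B * (N : ℝ) ^ b := by
  have hlim : Filter.Tendsto (fun N : ℕ => (N : ℝ) ^ (b - a)) Filter.atTop Filter.atTop :=
    (tendsto_rpow_atTop (by linarith)).comp tendsto_natCast_atTop_atTop
  obtain ⟨N, hN1, hN2⟩ := ((hlim.eventually_gt_atTop (A * 2 ^ a / B)).and
    (Filter.eventually_ge_atTop 1)).exists
  have hN : (1 : ℝ) ≤ N := by exact_mod_cast hN2
  have hN0 : (0 : ℝ) < N := by linarith
  refine ⟨N, ?_⟩
  rw [div_lt_iff₀ hB] at hN1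
  calc A * ((N : ℝ) + 1) ^ a ≤ A * (2 * (N : ℝ)) ^ a := by
        gcongr
        linarith
    _ = A * 2 ^ a * (N : ℝ) ^ a := by rw [Real.mul_rpow (by norm_num) hN0.le, mul_assoc]
    _ < (N : ℝ) ^ (b - a) * B * (N : ℝ) ^ a := by gcongr
    _ = B * (N : ℝ) ^ b := by
        rw [Real.rpow_sub hN0]
        have := (Real.rpow_pos_of_pos hN0 a).ne'
        field_simp

/-- The second Lorentz exponent `q / (1 - θ)` cannot be lowered. -/
theorem exists_lt_lorentzQuasiNorm_diffQuot {n : ℕ} (hn : 1 ≤ n) {t q θ p s γ : ℝ}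
    (ht0 : 0 < t) (ht1 : t < 1) (hq : 1 < q) (htq : 1 / q ≤ t)
    (hθ0 : 0 < θ) (hθ1 : θ < 1)
    (hp : 1 / p = (1 - θ) * (1 / q) + θ * 1) (hs : s = (1 - θ) * t + θ * 1)
    (hγ : γ ∉ Set.Icc (-1 : ℝ) 0) {r : ℝ} (hr0 : 0 < r) (hr : r < q / (1 - θ)) (C : ℝ≥0) :
    ∃ u : EuclideanSpace ℝ (Fin n) → ℝ, ContDiff ℝ ∞ u ∧ HasCompactSupport u ∧
        C * (fracSobolevNorm t q u ^ (1 - θ) * bvNorm u ^ θ)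
          < lorentzQuasiNorm p r (nuMeasure n γ) (diffQuot (s + γ / p) u) := by
  have hn' : (1 : ℝ) ≤ n := by exact_mod_cast hn
  have hq0 : 0 < q := by linarith
  have hq1 : q - 1 ≠ 0 := by linarith
  have hθ' : 0 < 1 - θ := by linarith
  have hp0 : 0 < p := by
    rw [← one_div_pos, hp]
    positivity
  have htq1 : 1 ≤ t * q := by
    rwa [div_le_iff₀ hq0] at htq
  -- The Hölder exponent critical for the Gagliardo seminorm; `t ≥ 1 / q` gives `d ≥ 0` and `t < 1`
  -- gives `d < 1`.
  obtain ⟨d, hd⟩ : ∃ d : ℝ, d = (t * q - 1) / (q - 1) := ⟨_, rfl⟩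
  have hd0 : 0 ≤ d := by
    rw [hd]
    exact div_nonneg (by linarith) (by linarith)
  have hd1 : d < 1 := by
    rw [hd, div_lt_one (by linarith)]
    nlinarith
  have hdq : d * (q - 1) = t * q - 1 := by
    rw [hd]
    field_simp
  set b := s + γ / p with hb
  -- The points `(1/q, t)`, `(1/p, s)` and `(1, 1)` lie on the line through `(0, d)` of slope `1 -
  -- d`. Hence levels and measures at the successive scales match the scaling of `L^{p,∞}`.
  have hκ : (b - d) * p = γ + 1 - d := by
    have h1 : t - d = (1 - d) * (1 / q) := by
      field_simp
      linarith
    have h2 : s - d = (1 - d) * (1 / p) := by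
      rw [hp, hs]
      linear_combination (1 - θ) * h1
    have h3 : b - d = (1 - d) * (1 / p) + γ / p := by
      rw [hb, ← h2]
      ring
    rw [h3]
    field_simp
    ring
  -- Equality would force `γ = d - 1`, which lies in `[-1, 0)`; otherwise the levels at different
  -- scales are genuinely distinct.
  have hκ0 : d - b ≠ 0 := by
    intro h0
    apply hγ
    have : b - d = 0 := by linarith
    rw [this, zero_mul] at hκ
    exact ⟨by linarith, by linarith⟩
  obtain ⟨α, l, hl0, hl, hα, hαd⟩ := exists_cantor_parameters hd0 hd1
  have hα0 : 1 / 2 ≤ α := by rcases hα with h | h <;> linarith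
  have hα1 : α ≤ 1 := by rcases hα with h | h <;> linarith
  let i : Fin n := ⟨0, hn⟩
  let η : ContDiffBump (0 : EuclideanSpace ℝ (Fin n)) :=
    ⟨4 * n, 8 * n, by linarith, by linarith⟩
  obtain ⟨c, c', hc, hc', hlow⟩ := exists_le_nuMeasure_cantorProfile i η le_rfl (d := d) (b := b)
    (γ := γ) hl0 hl hα hαd
  obtain ⟨V, hV, hup⟩ := exists_norm_cantorProfile_le i η ht0 ht1 hq hd0 hd1.le hdq hl0 hl hα0 hα1
    hαd
  set g := l ^ (d - b) with hg
  have hg0 : 0 < g := by positivity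
  have hg1 : g ≠ 1 := by
    intro h
    have h1 : (d - b) * Real.log l = 0 := by rw [← Real.log_rpow hl0, ← hg, h, Real.log_one]
    exact mul_ne_zero hκ0 (Real.log_neg hl0 (by linarith)).ne h1
  obtain ⟨a, ha, hlor⟩ := exists_le_lorentzQuasiNorm_of_geometric hp0 hr0 hg0 hg1 hc hc'
  have hgk : ∀ k : ℕ, (l ^ k) ^ (d - b) = g ^ k := fun k => by
    rw [hg, ← Real.rpow_natCast, ← Real.rpow_natCast, ← Real.rpow_mul hl0.le,
      ← Real.rpow_mul hl0.le, mul_comm]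
  have hgk' : ∀ k : ℕ, (l ^ k) ^ (γ + 1 - d) = (g ^ k) ^ (-p) := fun k => by
    rw [← hgk, ← Real.rpow_mul (by positivity), ← hκ]
    congr 1
    ring
  have hexp : (1 - θ) / q < 1 / r := by
    rw [← one_div_div]
    exact one_div_lt_one_div_of_lt hr0 hr
  obtain ⟨N, hN⟩ := exists_nat_mul_rpow_lt (A := C * (V ^ ((1 - θ) / q) * V ^ θ))
    (B := a ^ (1 / r)) (by positivity) (by positivity) (by positivity : 0 < (1 - θ) / q) hexp
  refine ⟨cantorProfile i η α l N, contDiff_cantorProfile i η α l N,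
    hasCompactSupport_cantorProfile i η α l N, ?_⟩
  have hN0 : (0 : ℝ) ≤ N := Nat.cast_nonneg N
  have hF : fracSobolevNorm t q (cantorProfile i η α l N) ^ (1 - θ) ≤
      ENNReal.ofReal (V * (N + 1)) ^ ((1 - θ) / q) := by
    have h1 := ENNReal.rpow_le_rpow (hup N).1 (by positivity : 0 ≤ (1 - θ) / q)
    rwa [← ENNReal.rpow_mul, mul_div_cancel₀ _ hq0.ne'] at h1
  calc _ ≤ (C : ℝ≥0∞) * (ENNReal.ofReal (V * (N + 1)) ^ ((1 - θ) / q) * ENNReal.ofReal V ^ θ) := by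
        gcongr
        exact (hup N).2
    _ = ENNReal.ofReal (C * (V ^ ((1 - θ) / q) * V ^ θ) * ((N : ℝ) + 1) ^ ((1 - θ) / q)) := by
        rw [ENNReal.ofReal_rpow_of_nonneg (by positivity) (by positivity),
          ENNReal.ofReal_rpow_of_nonneg hV.le hθ0.le, ← ENNReal.ofReal_mul (by positivity),
          ← ENNReal.ofReal_coe_nnreal, ← ENNReal.ofReal_mul C.coe_nonneg,
          Real.mul_rpow hV.le (by positivity)]
        congr 1
        ring
    _ < ENNReal.ofReal (a ^ (1 / r) * (N : ℝ) ^ (1 / r)) :=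
        (ENNReal.ofReal_lt_ofReal_iff_of_nonneg (by positivity)).2 hN
    _ = ENNReal.ofReal (a * N) ^ (1 / r) := by
        rw [ENNReal.ofReal_rpow_of_nonneg (by positivity) (by positivity),
          Real.mul_rpow ha.le hN0]
    _ ≤ _ := by
        refine hlor (nuMeasure n γ) _ N fun k hk y hy => ?_
        -- One profile with `N` generations serves all scales `k < N`, with `N - k` generations left
        -- below scale `l ^ k`.
        have := hlow k (N - k) y (by rwa [hgk])
        rwa [hgk', Nat.add_sub_cancel' hk.le] at this
theorem theorem7 (n : ℕ) (hn : 1 ≤ n) (t q θ p s γ : ℝ)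
    (ht0 : 0 < t) (ht1 : t < 1) (hq : 1 < q) (htq : 1 / q ≤ t)
    (hθ0 : 0 < θ) (hθ1 : θ < 1)
    (hp : 1 / p = (1 - θ) * (1 / q) + θ * 1) (hs : s = (1 - θ) * t + θ * 1)
    (hγ : γ ∉ Set.Icc (-1 : ℝ) 0) :
    (∃ C : ℝ≥0, ∀ u : EuclideanSpace ℝ (Fin n) → ℝ, MemBV u → MemFracSobolev t q u →
      lorentzQuasiNorm p (q / (1 - θ)) (nuMeasure n γ) (diffQuot (s + γ / p) u)
        ≤ C * (fracSobolevNorm t q u ^ (1 - θ) * bvNorm u ^ θ)) ∧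
    (∀ r : ℝ, 0 < r → r < q / (1 - θ) →
      ∀ C : ℝ≥0, ∃ u : EuclideanSpace ℝ (Fin n) → ℝ, ContDiff ℝ ∞ u ∧ HasCompactSupport u ∧
        C * (fracSobolevNorm t q u ^ (1 - θ) * bvNorm u ^ θ)
          < lorentzQuasiNorm p r (nuMeasure n γ) (diffQuot (s + γ / p) u)) := by
  exact ⟨exists_lorentzQuasiNorm_diffQuot_le hn hq hθ0 hθ1 hp hs hγ, fun r hr0 hr C =>
    exists_lt_lorentzQuasiNorm_diffQuot hn ht0 ht1 hq htq hθ0 hθ1 hp hs hγ hr0 hr C⟩
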